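/- **Model.** There are $J$ job types and a finite set $\mathcal K\subset\mathbb Z_+^J$ of feasible server configurations with $\mathbf 0\in\mathcal K$, closed under passing to componentwise smaller vectors and containing every unit vector $\mathbf e_j$. Type $j$ has a reward $u_j\ge 0$, an arrival rate $\lambda_j>0$ per server and a service rate $\mu_j>0$. For $\mathbf k\in\mathcal K$ put $U(\mathbf k)=\sum_j u_jk_j$, and write $\mathbf k\succ\mathbf k'$ if $U(\mathbf k)>U(\mathbf k')$, or $U(\mathbf k)=U(\mathbf k')$ and $k_j>k'_j$ at the smallest $j$ with $k_j\ne k_j'$. For a set $A$ of types, $\mathrm{MaxReward}(A)$ is the $\succ$-largest $\mathbf k\in\mathcal K$ with $k_j=0$ for $j\notin A$. The greedy configurations $\mathcal K^{(g)}$ are the values $\mathrm{MaxReward}(A)$ together with $\mathbf 0$. *Greedy placement (GPA)* with input $\hat{\mathbf Y}\in\mathbb R^J$ and $L$ servers: start with $A=\{1,\dots,J\}$, $\mathbf r=\hat{\mathbf Y}$, $N=L$. For $i=1,\dots,J$ let $\mathbf k[i]=\mathrm{MaxReward}(A)$, let $j^\star$ minimize $\lceil r_j/k_j[i]\rceil$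 over $j$ with $k_j[i]>0$ (ties broken arbitrarily), assign $\hat X_{\mathbf k[i]}=\min(\lceil r_{j^\star}/k_{j^\star}[i]\rceil^+,N)$ servers to $\mathbf k[i]$, and replace $\mathbf r$ by $\mathbf r-\hat X_{\mathbf k[i]}\mathbf k[i]$, $N$ by $N-\hat X_{\mathbf k[i]}$, $A$ by $A\setminus\{j^\star\}$. Put $\hat X_{\mathbf k}=0$ for all other $\mathbf k$. **The system with $L$ servers.** A state specifies for each server a configuration $\mathbf k\in\mathcal K$, a job placement $\tilde{\mathbf k}\le\mathbf k$ and an index, the servers in configuration $\mathbf k$ being indexed by $1,\dots,X_{\mathbf k}$ (index $1$ for the most recently assigned one). $Y_j$ is the number of type-$j$ jobs, and $\hat{\mathbf X}$ is the output of GPA for $\hat{\mathbf Y}=\mathbf Y+g(L)\mathbf 1$, where the reservation factor $g\ge0$ satisfies $g(L)=\omega(\log L)$ and $g(L)=o(L)$. The servers in configuration $\mathbf k[i]$ with index larger than $X_{\mathbf k[i]}-\hat X_{\mathbf k[i]}$ have rank $i$; all other servers have rank $J+1$. $I^\star$ is the first $i$ with $X_{\mathbf k[i]}<\hat X_{\mathbf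 k[i]}$ ($I^\star=J$ if there is none). Servers with rank $>I^\star$ and index $1$ form the Reject Group, the others the Accept Group. *Reassignment (CRA)*: compute $\hat{\mathbf X}$; for $i=1,\dots,J$ in turn, as long as $X_{\mathbf k[i]}<\hat X_{\mathbf k[i]}$ and some empty server has not been given a rank $\le i$, reassign such a server to $\mathbf k[i]$ (with rank $i$). *DRA.* Type-$j$ jobs arrive at the times of a Poisson process of rate $\lambda_jL$. An arriving job is put in an Accept Group server with an empty type-$j$ slot, and CRA is run; if there is no such server, the job is rejected. Every job in service departs at rate $\mu_j$. If a type-$j$ job departs from an Accept Group server and Reject Group servers contain type-$j$ jobs, one such job from a Reject Group server of highest rank is migrated to the vacated slot; after every departure CRA is run. The initial state is a state obtained by running CRA. All choices left open are made in an arbitrary, possibly randomized, way depending on the current state. The state process $\mathbf S^L(t)$ is thus a finite-state continuous-time Markov chain. Put $X^{L(e)}_{\mathbf k}=\min(X^L_{\mathbf k},\hat X^L_{\mathbf k})$, $x^{L(e)}_{\mathbf k}=X^{L(e)}_{\mathbf k}/L$ for $\mathbf k\in\mathcal K^{(g)}$, $y^L_j=Y^L_j/L$, and $\mathbf z^L=(\mathbf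 x^{L(e)},\mathbf y^L)$. Let $\mathcal Z$ be the set of all $(\mathbf x^{(e)},\mathbf y)$ with $x^{(e)}_{\mathbf k}\ge0$, $\sum_{\mathbf k\in\mathcal K^{(g)}} x^{(e)}_{\mathbf k}\le1$, $\sum_{\mathbf k\in\mathcal K^{(g)}} x^{(e)}_{\mathbf k}\mathbf k\le\mathbf y$, and $\mathbf y\le\sum_{\mathbf k\in\mathcal K}x_{\mathbf k}\mathbf k$ for some $x_{\mathbf k}\ge0$ with $\sum_{\mathbf k\in\mathcal K} x_{\mathbf k}=1$. **Proposition (existence of fluid limits).** Let $L_1<L_2<\cdots$ and let $\mathbf S^{L_n}$, $n\ge1$, be systems under DRA with $L_n$ servers, with arbitrary (possibly random) initial states as above (in particular, with $\mathbf z^{L_n}(0)\in\mathcal Z$), defined on a common probability space. There is a constant $C$ such that the following hold. 1. For almost every sample point, every subsequence of $(\mathbf z^{L_n})$ has a further subsequence (which may depend on the sample point) along which $\mathbf z^{L_n}(t)\to\mathbf z(t)=(\mathbf x^{(e)}(t),\mathbf y(t))$ uniformly on compact time intervals, and every limit $\mathbf z$ of this kind along any subsequence (every fluid limit sample path) is Lipschitz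 continuous with constant $C$ and satisfies $\mathbf z(t)\in\mathcal Z$ for all $t\ge0$. 2. There are a probability space carrying, for every $n$, a copy of $\mathbf S^{L_n}$ with the same law, and a nonrandom subsequence along which, for these copies, almost surely, $\mathbf z^{L_n}(t)\to\mathbf z(t)$ uniformly on compact time intervals, where $\mathbf z$ is Lipschitz continuous with constant $C$ and $\mathbf z(t)\in\mathcal Z$ for all $t\ge0$. -/

import Mathlib

open MeasureTheory Filter Topology Asymptotics
open scoped NNReal ENNReal

universe u

namespace DRA

/-- A cloud with `J` VM (job) types: the finite, downward closed set `K` of feasible server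
configurations, in which every type fits in an empty server, the rewards, and the arrival
(per server) and service rates. -/
structure CloudModel (J : ℕ) where
  K : Finset (Fin J → ℕ)
  zero_mem : 0 ∈ K
  down_closed : ∀ k ∈ K, ∀ k' : Fin J → ℕ, k' ≤ k → k' ∈ K
  single_mem : ∀ j : Fin J, Pi.single j 1 ∈ K
  reward : Fin J → ℝ
  reward_nonneg : ∀ j, 0 ≤ reward j
  lam : Fin J → ℝ
  lam_pos : ∀ j, 0 < lam j
  mu : Fin J → ℝ
  mu_pos : ∀ j, 0 < mu j

variable {J : ℕ}

/-- The type of feasible configurations. -/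
abbrev CloudModel.Config (M : CloudModel J) : Type := {k : Fin J → ℕ // k ∈ M.K}

/-- The reward of a configuration with all slots filled. -/
def CloudModel.U (M : CloudModel J) (k : M.Config) : ℝ := ∑ j, M.reward j * (k.1 j : ℝ)

/-- The configuration ordering `k ≻ k'`: larger reward, ties broken lexicographically. -/
def CloudModel.Better (M : CloudModel J) (k k' : M.Config) : Prop :=
  M.U k' < M.U k ∨
    (M.U k = M.U k' ∧ ∃ j, (∀ i, i < j → k.1 i = k'.1 i) ∧ k'.1 j < k.1 j)

/-- `k` is the maximum reward configuration among those using only job types in `A`. -/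
def CloudModel.IsMaxReward (M : CloudModel J) (A : Finset (Fin J)) (k : M.Config) : Prop :=
  (∀ j, j ∉ A → k.1 j = 0) ∧
    ∀ k' : M.Config, (∀ j, j ∉ A → k'.1 j = 0) → k' ≠ k → M.Better k k'

/-- The greedy configurations: all possible outputs of the maximum reward rule, and the empty
configuration. -/
abbrev CloudModel.GreedyConfig (M : CloudModel J) : Type :=
  {k : M.Config // k.1 = 0 ∨ ∃ A : Finset (Fin J), M.IsMaxReward A k}

noncomputable instance (M : CloudModel J) : Fintype M.GreedyConfig := Fintype.ofFinite _

/-- Runs of the Greedy Placement Algorithm. `GPARun M A r N out` says that the loop, started with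
candidate job types `A`, remaining workload `r` and `N` unused servers, can return the list `out`
of pairs (configuration, number of servers to be assigned to it); ties in the choice of the
exhausted job type `j` are broken arbitrarily. A job type that has no jobs left needs no
further server, whence `Int.toNat`. -/
inductive GPARun (M : CloudModel J) :
    Finset (Fin J) → (Fin J → ℝ) → ℕ → List (M.Config × ℕ) → Prop
  | done (r : Fin J → ℝ) (N : ℕ) : GPARun M ∅ r N []
  | step (A : Finset (Fin J)) (r : Fin J → ℝ) (N : ℕ) (k : M.Config) (j : Fin J) (x : ℕ)
      (out : List (M.Config × ℕ)) (hA : A.Nonempty) (hk : M.IsMaxReward A k) (hj : 0 < k.1 j)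
      (hmin : ∀ i, 0 < k.1 i → ⌈r j / (k.1 j : ℝ)⌉ ≤ ⌈r i / (k.1 i : ℝ)⌉)
      (hx : x = min (⌈r j / (k.1 j : ℝ)⌉).toNat N)
      (hrest : GPARun M (A.erase j) (fun i => r i - (x : ℝ) * (k.1 i : ℝ)) (N - x) out) :
      GPARun M A r N ((k, x) :: out)

/-- The state of the system with `L` servers: configuration, job placement, and index of each
server; the servers in the same configuration `k` are indexed bijectively by `1, ..., X k`. -/
structure State (M : CloudModel J) (L : ℕ) where
  cfg : Fin L → M.Config
  plc : Fin L → Fin J → ℕ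
  idx : Fin L → ℕ
  plc_le : ∀ l, plc l ≤ (cfg l).1
  idx_pos : ∀ l, 1 ≤ idx l
  idx_le : ∀ l, idx l ≤ (Finset.univ.filter fun m => cfg m = cfg l).card
  idx_inj : ∀ l m, cfg l = cfg m → idx l = idx m → l = m

namespace State

variable {M : CloudModel J} {L : ℕ}

instance : Finite (State M L) := by
  have hlt : ∀ (s : State M L) (l : Fin L), s.idx l < L + 1 := fun s l =>
    Nat.lt_succ_of_le ((s.idx_le l).trans ((Finset.card_le_univ _).trans (by simp)))
  let F : State M L → (Fin L → M.Config) × (Fin L → M.Config) × (Fin L → Fin (L + 1)) :=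
    fun s => (s.cfg, fun l => ⟨s.plc l, M.down_closed _ (s.cfg l).2 _ (s.plc_le l)⟩,
      fun l => ⟨s.idx l, hlt s l⟩)
  apply Finite.of_injective F
  intro s t h
  have h1 : s.cfg = t.cfg := congrArg (fun p => p.1) h
  have h2 : s.plc = t.plc := by
    funext l
    exact congrArg Subtype.val (congrFun (congrArg (fun p => p.2.1) h) l)
  have h3 : s.idx = t.idx := by
    funext l
    exact congrArg Fin.val (congrFun (congrArg (fun p => p.2.2) h) l)
  cases s
  cases t
  simp only at h1 h2 h3
  subst h1 h2 h3
  rfl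

noncomputable instance : Fintype (State M L) := Fintype.ofFinite _

noncomputable instance : DecidableEq (State M L) := Classical.decEq _

instance : MeasurableSpace (State M L) := ⊤

/-- Number of servers in configuration `k`. -/
def X (s : State M L) (k : M.Config) : ℕ := (Finset.univ.filter fun l => s.cfg l = k).card

/-- Number of type-`j` jobs in the system. -/
def Y (s : State M L) (j : Fin J) : ℕ := ∑ l, s.plc l j

/-- Server `l` has no jobs. -/
def IsEmpty (s : State M L) (l : Fin L) : Prop := s.plc l = 0

/-- For `p = (k, x)`: server `l` is one of the `min (X k) x` servers of largest index in
configuration `k`. -/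
def Ranked (s : State M L) (p : M.Config × ℕ) (l : Fin L) : Prop :=
  s.cfg l = p.1 ∧ s.X p.1 - p.2 < s.idx l

/-- The rank of server `l` for the output `out` of the greedy algorithm: `i` if it is ranked for
the `i`-th entry, `out.length + 1` if it is ranked for none. -/
noncomputable def rank (s : State M L) (out : List (M.Config × ℕ)) (l : Fin L) : ℕ :=
  open Classical in out.findIdx (fun p => decide (s.Ranked p l)) + 1

/-- The position of the first entry of `out` that is not matched by the system (the number of
entries if all are matched). -/
noncomputable def iStar (s : State M L) (out : List (M.Config × ℕ)) : ℕ :=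
  min (out.findIdx (fun p => decide (s.X p.1 < p.2)) + 1) out.length

/-- Reject Group membership; all other servers form the Accept Group. -/
def InRG (s : State M L) (out : List (M.Config × ℕ)) (l : Fin L) : Prop :=
  s.iStar out < s.rank out l ∧ s.idx l = 1

/-- `s'` arises from `s` by assigning server `l` to configuration `k`: it gets index `1` there,
and the other indices are shifted accordingly. -/
def Reassigned (s : State M L) (l : Fin L) (k : M.Config) (s' : State M L) : Prop :=
  s'.cfg = Function.update s.cfg l k ∧ s'.plc = s.plc ∧ s'.idx l = 1 ∧
    ∀ m, m ≠ l → s'.idx m + (if s.cfg m = s.cfg l ∧ s.idx l < s.idx m then 1 else 0) =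
      s.idx m + (if s.cfg m = k then 1 else 0)

/-- `s'` arises from `s` by adding a type-`j` job to server `l`. -/
def JobAdded (s : State M L) (l : Fin L) (j : Fin J) (s' : State M L) : Prop :=
  s'.cfg = s.cfg ∧ s'.idx = s.idx ∧ s'.plc = Function.update s.plc l (s.plc l + Pi.single j 1)

/-- `s'` arises from `s` by removing a type-`j` job from server `l`. -/
def JobRemoved (s : State M L) (l : Fin L) (j : Fin J) (s' : State M L) : Prop :=
  JobAdded s' l j s

end State

/-- One iteration of the classification and reassignment algorithm, for the entry `p = (k, x)`;
`done` lists the entries treated so far, including `p`. As long as fewer than `x` servers are in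
configuration `k` and there is an empty server not yet ranked, any such server is reassigned
to `k`. -/
inductive CRAFill {M : CloudModel J} {L : ℕ} (done : List (M.Config × ℕ)) (p : M.Config × ℕ) :
    State M L → State M L → Prop
  | finish (s : State M L)
      (h : p.2 ≤ s.X p.1 ∨ ¬ ∃ l, s.IsEmpty l ∧ ∀ q ∈ done, ¬ s.Ranked q l) : CRAFill done p s s
  | step (s s' s'' : State M L) (l : Fin L) (hX : s.X p.1 < p.2) (hl : s.IsEmpty l)
      (hr : ∀ q ∈ done, ¬ s.Ranked q l) (hs : s.Reassigned l p.1 s')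
      (hrest : CRAFill done p s' s'') : CRAFill done p s s''

/-- Runs of the classification and reassignment algorithm: the entries of the list `todo` are
treated in order, those in `done` have been treated. -/
inductive CRARun {M : CloudModel J} {L : ℕ} :
    List (M.Config × ℕ) → List (M.Config × ℕ) → State M L → State M L → Prop
  | nil (done : List (M.Config × ℕ)) (s : State M L) : CRARun done [] s s
  | cons (done todo : List (M.Config × ℕ)) (p : M.Config × ℕ) (s s' s'' : State M L)
      (hp : CRAFill (done ++ [p]) p s s') (hrest : CRARun (done ++ [p]) todo s' s'') :
      CRARun done (p :: todo) s s''

section Steps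

variable {M : CloudModel J} {L : ℕ}

/-- The workload reference vector with reservation `γ`. -/
def workloadRef (γ : ℝ) (s : State M L) : Fin J → ℝ := fun j => (s.Y j : ℝ) + γ

/-- `s'` is a possible result of running the classification and reassignment algorithm at `s`,
where `gpa` is the map given by the Greedy Placement Algorithm. -/
def CRA (γ : ℝ) (gpa : (Fin J → ℝ) → List (M.Config × ℕ)) (s s' : State M L) : Prop :=
  CRARun [] (gpa (workloadRef γ s)) s s'

/-- `s'` is a possible state after a type-`j` arrival at state `s`: the job goes to some Accept
Group server with an empty type-`j` slot and the servers are reclassified; the job is rejected if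
there is no such server. -/
def ArrivalStep (γ : ℝ) (gpa : (Fin J → ℝ) → List (M.Config × ℕ)) (s : State M L) (j : Fin J)
    (s' : State M L) : Prop :=
  let out := gpa (workloadRef γ s)
  (∃ l, ¬ s.InRG out l ∧ s.plc l j < (s.cfg l).1 j ∧ ∃ s1, s.JobAdded l j s1 ∧ CRA γ gpa s1 s') ∨
    ((¬ ∃ l, ¬ s.InRG out l ∧ s.plc l j < (s.cfg l).1 j) ∧ s' = s)

/-- `s'` is a possible state after a type-`j` job in server `l` departs at state `s`. If `l` is in
the Accept Group and Reject Group servers have type-`j` jobs, then one from a server `m` of highest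
rank among them is migrated to the emptied slot, so that in total `m` loses a job; otherwise `l`
loses a job. Then the servers are reclassified. -/
def DepartureStep (γ : ℝ) (gpa : (Fin J → ℝ) → List (M.Config × ℕ)) (s : State M L) (l : Fin L)
    (j : Fin J) (s' : State M L) : Prop :=
  let out := gpa (workloadRef γ s)
  (∃ m, ¬ s.InRG out l ∧ s.InRG out m ∧ 0 < s.plc m j ∧
      (∀ m', s.InRG out m' → 0 < s.plc m' j → s.rank out m' ≤ s.rank out m) ∧
      ∃ s1, s.JobRemoved m j s1 ∧ CRA γ gpa s1 s') ∨
    ((s.InRG out l ∨ ¬ ∃ m, s.InRG out m ∧ 0 < s.plc m j) ∧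
      ∃ s1, s.JobRemoved l j s1 ∧ CRA γ gpa s1 s')

end Steps

/-- A realization of the Dynamic Reservation Algorithm with reservation `γ` in the system with `L`
servers: everything that the algorithm leaves open (ties and choices among several admissible
servers) is decided in an arbitrary, possibly randomized, way depending on the current state. -/
structure Rule (M : CloudModel J) (L : ℕ) (γ : ℝ) where
  gpa : (Fin J → ℝ) → List (M.Config × ℕ)
  gpa_spec : ∀ Yhat, GPARun M Finset.univ Yhat L (gpa Yhat)
  arr : State M L → Fin J → PMF (State M L)
  arr_spec : ∀ s j, ∀ s' ∈ (arr s j).support, ArrivalStep γ gpa s j s'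
  dep : State M L → Fin L → Fin J → PMF (State M L)
  dep_spec : ∀ s l j, 0 < s.plc l j → ∀ s' ∈ (dep s l j).support, DepartureStep γ gpa s l j s'

namespace Rule

variable {M : CloudModel J} {L : ℕ} {γ : ℝ}

/-- The generator (matrix of transition rates): type-`j` jobs arrive at rate `lam j * L`, and each
type-`j` job in service departs at rate `mu j`. -/
noncomputable def generator (R : Rule M L γ) : Matrix (State M L) (State M L) ℝ := fun s s' =>
  (∑ j, M.lam j * (L : ℝ) * ((R.arr s j s').toReal - if s' = s then 1 else 0)) +
    ∑ l, ∑ j, M.mu j * (s.plc l j : ℝ) * ((R.dep s l j s').toReal - if s' = s then 1 else 0)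

/-- Number of servers that the greedy algorithm assigns to `k` at state `s`. -/
noncomputable def Xhat (R : Rule M L γ) (s : State M L) (k : M.Config) : ℕ :=
  (((R.gpa (workloadRef γ s)).filter fun p => decide (p.1 = k)).map fun p => p.2).sum

/-- Effective number of servers in configuration `k`. -/
noncomputable def Xeff (R : Rule M L γ) (s : State M L) (k : M.Config) : ℕ :=
  min (s.X k) (R.Xhat s k)

/-- The scaled state `(x^(e), y)`. -/
noncomputable def scaled (R : Rule M L γ) (s : State M L) :
    (M.GreedyConfig → ℝ) × (Fin J → ℝ) :=
  (fun k => (R.Xeff s k.1 : ℝ) / (L : ℝ), fun j => (s.Y j : ℝ) / (L : ℝ))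

end Rule

/-- `S` is a continuous-time Markov chain with generator `Q` on the finite set `E`, with
right-continuous piecewise constant paths. -/
structure IsMarkovChain {E : Type*} [Fintype E] [DecidableEq E] [MeasurableSpace E] {Ω : Type*}
    [MeasurableSpace Ω] (Q : Matrix E E ℝ) (S : ℝ≥0 → Ω → E) (P : Measure Ω) : Prop where
  measurable : ∀ t, Measurable (S t)
  right_cont : ∀ ω t, ∀ᶠ r in 𝓝[>] t, S r ω = S t ω
  left_lim : ∀ ω t, ∃ a, ∀ᶠ r in 𝓝[<] t, S r ω = a
  markov : ∀ (s t : ℝ≥0) (a b : E) (A : Set Ω),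
    MeasurableSet[⨆ r ∈ Set.Iic s, MeasurableSpace.comap (S r) inferInstance] A →
    P.real (A ∩ {ω | S s ω = a} ∩ {ω | S (s + t) ω = b}) =
      P.real (A ∩ {ω | S s ω = a}) * NormedSpace.exp ((t : ℝ) • Q) a b

/-- `S` is the state process of the system with `L` servers operated by the Dynamic Reservation
Algorithm: a Markov chain with the corresponding rates, started from a state obtained by running
the classification and reassignment algorithm on some state. -/
structure IsDRAProcess {M : CloudModel J} {L : ℕ} {γ : ℝ} (R : Rule M L γ) {Ω : Type*}
    [MeasurableSpace Ω] (S : ℝ≥0 → Ω → State M L) (P : Measure Ω) : Prop where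
  chain : IsMarkovChain R.generator S P
  init : ∀ᵐ ω ∂P, ∃ s0, CRA γ R.gpa s0 (S 0 ω)

/-- The workloads that can be accommodated (per server). -/
def CloudModel.Lambda (M : CloudModel J) : Set (Fin J → ℝ) :=
  {y | ∃ x : M.Config → ℝ, (∀ k, 0 ≤ x k) ∧ ∑ k, x k = 1 ∧ ∀ j, y j ≤ ∑ k, x k * (k.1 j : ℝ)}

/-- The space of fluid states. -/
def CloudModel.Z (M : CloudModel J) : Set ((M.GreedyConfig → ℝ) × (Fin J → ℝ)) :=
  {z | z.2 ∈ M.Lambda ∧ (∀ k, 0 ≤ z.1 k) ∧ ∑ k, z.1 k ≤ 1 ∧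
    ∀ j, ∑ k, z.1 k * (k.1.1 j : ℝ) ≤ z.2 j}

/-- Uniform convergence on compact time intervals. -/
def UOC {V : Type*} [UniformSpace V] (f : ℕ → ℝ≥0 → V) (z : ℝ≥0 → V) : Prop :=
  ∀ T : ℝ≥0, TendstoUniformlyOn f z atTop (Set.Icc 0 T)

end DRA

/-!
A system with `L` servers has events at total rate `O(L)`, and the whole proof rests on the fact
that a single event changes the unscaled effective state `(X^(e), Y)` by an amount bounded in
terms of the model only.

*Bounded jumps.* The output of the greedy algorithm is not a continuous function of the workload
entry by entry, since the order in which types are exhausted, and with it the configurations used,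
may change. But two runs from similar workloads are aligned (`GPARun.align`): after entries with
few servers have been dropped, they use the same configurations in the same order with similar
numbers of servers. The reason is that a type that is still a candidate in only one of the runs
has almost no workload left there, so that an iteration using it places few servers. States
produced by the reassignment algorithm are stable: an entry is either matched, or all empty
servers are ranked for it or for earlier entries. When the target changes to an aligned one, a
matched entry lacks few servers, while for an unmatched one there are few empty servers available,
namely those that lost their rank. Hence few servers move (`Align.exists_shift`), and
`Rule.close_of_event` follows. Stable states are closed under the transitions, so only they matter.

*Regularity.* For a finite Markov chain observed on a regular grid, the exponential moment of the
path variation is at most a power of the largest weighted row sum of the one-step transition matrix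
(`IsMarkovChain.lintegral_prod_le`). Refining the grid leaves only the generator, and the Markov
inequality bounds the oscillation over an interval of length `d` by a multiple of `d * L`, except
for a probability exponentially small in `L` (`IsMarkovChain.measure_oscillation_le`). As
`n ≤ L n`, the Borel-Cantelli lemma shows that almost surely the scaled paths are Lipschitz up to
vanishing errors, with a constant that depends only on the model
(`exists_forall_ae_asympLipschitz`). This gives relative compactness, as in the Arzelà-Ascoli
theorem, and the Lipschitz continuity of the limits. That limits lie in `Z` is a closedness
argument; the reservation disappears because it is `o(L)`.

*Almost sure convergence.* Since the regularity statement holds for every joint construction, it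
suffices to find a coupling for which the values at countably many times converge. It is built on
`ℕ → Ω`: along a subsequence the laws of finite discretizations of the systems converge, so that
consecutive systems can be coupled maximally with summable failure probabilities; the couplings are
chained by the Ionescu-Tulcea theorem (`exists_chain_coupling`, `exists_coupling_tendsto`). Every
system is then the original process evaluated at one coordinate, so it keeps its law.
-/

namespace DRA

variable {J : ℕ} {M : CloudModel J}

/-! ### Stability of the greedy placement algorithm -/

theorem CloudModel.exists_slot_bound (M : CloudModel J) :
    ∃ B : ℕ, 0 < B ∧ ∀ (k : M.Config) (j : Fin J), k.1 j ≤ B := by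
  refine ⟨(∑ k : M.Config, ∑ j, k.1 j) + 1, Nat.succ_pos _, fun k j => ?_⟩
  have h1 : k.1 j ≤ ∑ j, k.1 j :=
    Finset.single_le_sum (fun _ _ => Nat.zero_le _) (Finset.mem_univ j)
  have h2 : ∑ j, k.1 j ≤ ∑ k : M.Config, ∑ j, k.1 j :=
    Finset.single_le_sum (f := fun k : M.Config => ∑ j, k.1 j) (fun _ _ => Nat.zero_le _)
      (Finset.mem_univ k)
  omega

theorem CloudModel.Better.not_symm {k k' : M.Config} (h : M.Better k k') : ¬ M.Better k' k := by
  rintro (h' | ⟨hU', j', hj', hlt'⟩)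
  · rcases h with h | ⟨hU, -⟩ <;> linarith
  · rcases h with h | ⟨hU, j, hj, hlt⟩
    · linarith
    · rcases lt_trichotomy j j' with h | h | h
      · have := hj' j h; omega
      · subst h; omega
      · have := hj j' h; omega

/-- If the maximum reward configurations of two sets of types only use common types, they agree. -/
theorem CloudModel.IsMaxReward.eq_of_support {A A' : Finset (Fin J)} {k k' : M.Config}
    (hk : M.IsMaxReward A k) (hk' : M.IsMaxReward A' k')
    (h : ∀ j ∈ A, j ∉ A' → k.1 j = 0) (h' : ∀ j ∈ A', j ∉ A → k'.1 j = 0) : k = k' := by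
  by_contra hne
  have h1 : M.Better k k' := hk.2 k' (fun j hj => by
    by_cases hj' : j ∈ A'
    · exact h' j hj' hj
    · exact hk'.1 j hj') (Ne.symm hne)
  have h2 : M.Better k' k := hk'.2 k (fun j hj => by
    by_cases hj' : j ∈ A
    · exact h j hj' hj
    · exact hk.1 j hj') hne
  exact h1.not_symm h2

/-- Two lists of pairs (configuration, number of servers) agree up to entries with at most `D`
servers: after such entries have been dropped, the lists run through the same configurations in
the same order, and the numbers of servers differ by at most `D`. -/
inductive Align (D : ℕ) : List (M.Config × ℕ) → List (M.Config × ℕ) → Prop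
  | nil : Align D [] []
  | left (p : M.Config × ℕ) (a b : List (M.Config × ℕ)) (hp : p.2 ≤ D) (h : Align D a b) :
      Align D (p :: a) b
  | right (p : M.Config × ℕ) (a b : List (M.Config × ℕ)) (hp : p.2 ≤ D) (h : Align D a b) :
      Align D a (p :: b)
  | both (k : M.Config) (x x' : ℕ) (a b : List (M.Config × ℕ)) (h1 : x ≤ x' + D)
      (h2 : x' ≤ x + D) (h : Align D a b) : Align D ((k, x) :: a) ((k, x') :: b)

theorem Align.symm {D : ℕ} {a b : List (M.Config × ℕ)} (h : Align D a b) : Align D b a := by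
  induction h with
  | nil => exact .nil
  | left p a b hp _ ih => exact .right p b a hp ih
  | right p a b hp _ ih => exact .left p b a hp ih
  | both k x x' a b h1 h2 _ ih => exact .both k x' x b a h2 h1 ih

theorem GPARun.sum_le {A : Finset (Fin J)} {r : Fin J → ℝ} {N : ℕ} {out : List (M.Config × ℕ)}
    (h : GPARun M A r N out) : (out.map fun p => p.2).sum ≤ N := by
  induction h with
  | done => simp
  | step A r N k j x out hA hk hj hmin hx hrest ih =>
    simp only [List.map_cons, List.sum_cons]
    have : x ≤ N := hx ▸ min_le_right _ _
    omega

theorem CloudModel.IsMaxReward.mem_of_pos {A : Finset (Fin J)} {k : M.Config}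
    (hk : M.IsMaxReward A k) {j : Fin J} (hj : 0 < k.1 j) : j ∈ A := by
  by_contra h
  have := hk.1 j h
  omega

theorem GPARun.length_eq {A : Finset (Fin J)} {r : Fin J → ℝ} {N : ℕ}
    {out : List (M.Config × ℕ)} (h : GPARun M A r N out) : out.length = A.card := by
  induction h with
  | done => simp
  | step A r N k j x out hA hk hj hmin hx hrest ih =>
    have hjA : j ∈ A := hk.mem_of_pos hj
    rw [List.length_cons, ih, Finset.card_erase_add_one hjA]

/-- The number of servers given to a configuration overshoots the workload of no type by more
than the jobs of one server. -/
theorem GPARun.sum_mul_le {B : ℕ} (hB : ∀ (k : M.Config) (j : Fin J), k.1 j ≤ B)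
    {A : Finset (Fin J)} {r : Fin J → ℝ} {N : ℕ} {out : List (M.Config × ℕ)}
    (h : GPARun M A r N out) (i : Fin J) (hr : -(B : ℝ) ≤ r i) :
    (out.map fun p => (p.2 : ℝ) * (p.1.1 i : ℝ)).sum ≤ r i + B := by
  induction h with
  | done => simp; linarith
  | step A r N k j x out hA hk hj hmin hx hrest ih =>
    simp only [List.map_cons, List.sum_cons]
    have key : -(B : ℝ) ≤ r i - (x : ℝ) * (k.1 i : ℝ) := by
      rcases Nat.eq_zero_or_pos (k.1 i) with h0 | hpos
      · simpa [h0] using hr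
      rcases Nat.eq_zero_or_pos x with h0 | hxpos
      · simpa [h0] using hr
      have hk0 : (0 : ℝ) < k.1 i := by exact_mod_cast hpos
      have h1 : x ≤ (⌈r j / (k.1 j : ℝ)⌉).toNat := hx ▸ min_le_left _ _
      have h2 : (x : ℤ) ≤ ⌈r i / (k.1 i : ℝ)⌉ := by
        have := hmin i hpos
        omega
      have h3 : (x : ℝ) ≤ (⌈r i / (k.1 i : ℝ)⌉ : ℝ) := by exact_mod_cast h2
      have h4 := Int.ceil_lt_add_one (r i / (k.1 i : ℝ))
      have h5 : ((x : ℝ) - 1) * (k.1 i : ℝ) < r i := by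
        rw [← lt_div_iff₀ hk0]; linarith
      have h6 : (k.1 i : ℝ) ≤ B := by exact_mod_cast hB k i
      linarith
    have := ih key
    linarith

/-- Two situations in runs of the greedy algorithm are the same up to `D`: either both have at
most `D` servers left, or the workloads and the numbers of servers differ by at most `D`, and
types that are candidates in only one of them are exhausted there up to `D`. -/
def Compat (D : ℕ) (A : Finset (Fin J)) (r : Fin J → ℝ) (N : ℕ) (A' : Finset (Fin J))
    (r' : Fin J → ℝ) (N' : ℕ) : Prop :=
  (N ≤ D ∧ N' ≤ D) ∨ ((∀ j, |r j - r' j| ≤ D) ∧ N ≤ N' + D ∧ N' ≤ N + D ∧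
    (∀ j ∈ A, j ∉ A' → r j ≤ D) ∧ (∀ j ∈ A', j ∉ A → r' j ≤ D))

theorem Compat.symm {D : ℕ} {A A' : Finset (Fin J)} {r r' : Fin J → ℝ} {N N' : ℕ}
    (h : Compat D A r N A' r' N') : Compat D A' r' N' A r N := by
  rcases h with ⟨h1, h2⟩ | ⟨h1, h2, h3, h4, h5⟩
  · exact .inl ⟨h2, h1⟩
  · exact .inr ⟨fun j => by rw [abs_sub_comm]; exact h1 j, h3, h2, h5, h4⟩

/-- An iteration that uses some type that is a candidate in only one of two similar situations
places few servers, and similarity persists. -/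
theorem Compat.step_left {B D : ℕ} (hB : ∀ (k : M.Config) (j : Fin J), k.1 j ≤ B)
    {A A' : Finset (Fin J)} {r r' : Fin J → ℝ} {N N' : ℕ} (h : Compat D A r N A' r' N')
    {k : M.Config} {j : Fin J} {x : ℕ} (hj : 0 < k.1 j)
    (hmin : ∀ i, 0 < k.1 i → ⌈r j / (k.1 j : ℝ)⌉ ≤ ⌈r i / (k.1 i : ℝ)⌉)
    (hx : x = min (⌈r j / (k.1 j : ℝ)⌉).toNat N)
    (hi : ∃ i ∈ A, i ∉ A' ∧ 0 < k.1 i) :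
    x ≤ D ∧ Compat (D * (B + 2)) (A.erase j) (fun i => r i - (x : ℝ) * (k.1 i : ℝ)) (N - x)
      A' r' N' := by
  have hDD : D ≤ D * (B + 2) := Nat.le_mul_of_pos_right _ (by omega)
  rcases h with ⟨h1, h2⟩ | ⟨h1, h2, h3, h4, h5⟩
  · exact ⟨(hx ▸ min_le_right _ _ : x ≤ N).trans h1, .inl ⟨by omega, by omega⟩⟩
  obtain ⟨i, hiA, hiA', hki⟩ := hi
  -- `k` uses the type `i`, which has at most `D` jobs left
  have hceil : ⌈r j / (k.1 j : ℝ)⌉ ≤ (D : ℤ) := by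
    refine (hmin i hki).trans (Int.ceil_le.2 ?_)
    have hk1 : (1 : ℝ) ≤ k.1 i := by exact_mod_cast hki
    rw [div_le_iff₀ (by linarith)]
    have := h4 i hiA hiA'
    push_cast
    nlinarith [Nat.cast_nonneg (α := ℝ) D]
  have hxD : x ≤ D := by
    rw [hx]; refine (min_le_left _ _).trans ?_; omega
  refine ⟨hxD, ?_⟩
  have hexp : D * (B + 2) = D * B + D + D := by ring
  have hchg : ∀ i, (0 : ℝ) ≤ (x : ℝ) * (k.1 i : ℝ) ∧ (x : ℝ) * (k.1 i : ℝ) ≤ (D : ℝ) * B := by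
    intro i
    refine ⟨by positivity, ?_⟩
    exact_mod_cast Nat.mul_le_mul hxD (hB k i)
  have hcast : ((D * (B + 2) : ℕ) : ℝ) = D * B + D + D := by rw [hexp]; push_cast; ring
  have hD0 : (0 : ℝ) ≤ D := Nat.cast_nonneg _
  -- either the iteration uses up all servers, or it exhausts the type `j`
  rcases le_or_gt N x with hNx | hNx
  · exact .inl ⟨by omega, by rw [hexp]; omega⟩
  refine .inr ⟨fun i => ?_, by rw [hexp]; omega, by rw [hexp]; omega, fun i hi hi' => ?_,
    fun i hi hi' => ?_⟩
  · have := abs_le.1 (h1 i)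
    have := hchg i
    rw [hcast, abs_le]
    constructor <;> linarith
  · have := h4 i (Finset.mem_of_mem_erase hi) hi'
    have := hchg i
    have : (0 : ℝ) ≤ D * B := by positivity
    rw [hcast]; linarith
  · rw [hcast]
    have : (0 : ℝ) ≤ D * B := by positivity
    by_cases hiA : i ∈ A
    · have hij : i = j := by
        by_contra hne; exact hi' (Finset.mem_erase.2 ⟨hne, hiA⟩)
      subst hij
      have hle : r i / (k.1 i : ℝ) ≤ x := by
        have h6 : (⌈r i / (k.1 i : ℝ)⌉).toNat ≤ x := by
          rw [hx] at hNx ⊢; omega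
        have h7 : ⌈r i / (k.1 i : ℝ)⌉ ≤ (x : ℤ) := by omega
        exact_mod_cast Int.ceil_le.1 h7
      have hk0 : (0 : ℝ) < k.1 i := by exact_mod_cast hj
      rw [div_le_iff₀ hk0] at hle
      have := abs_le.1 (h1 i)
      have := hchg i
      linarith
    · have := h5 i hi hiA
      linarith

/-- Iterations with the same configuration in two similar situations place similar numbers of
servers, and similarity persists. -/
theorem Compat.step_both {B D : ℕ} (hB : ∀ (k : M.Config) (j : Fin J), k.1 j ≤ B)
    {A A' : Finset (Fin J)} {r r' : Fin J → ℝ} {N N' : ℕ} (h : Compat D A r N A' r' N')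
    {k : M.Config} {j j' : Fin J} {x x' : ℕ} (hj : 0 < k.1 j) (hj' : 0 < k.1 j')
    (hmin : ∀ i, 0 < k.1 i → ⌈r j / (k.1 j : ℝ)⌉ ≤ ⌈r i / (k.1 i : ℝ)⌉)
    (hmin' : ∀ i, 0 < k.1 i → ⌈r' j' / (k.1 j' : ℝ)⌉ ≤ ⌈r' i / (k.1 i : ℝ)⌉)
    (hx : x = min (⌈r j / (k.1 j : ℝ)⌉).toNat N)
    (hx' : x' = min (⌈r' j' / (k.1 j' : ℝ)⌉).toNat N') :
    (x ≤ x' + D ∧ x' ≤ x + D) ∧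
      Compat (D * (B + 2)) (A.erase j) (fun i => r i - (x : ℝ) * (k.1 i : ℝ)) (N - x)
        (A'.erase j') (fun i => r' i - (x' : ℝ) * (k.1 i : ℝ)) (N' - x') := by
  have hDD : D ≤ D * (B + 2) := Nat.le_mul_of_pos_right _ (by omega)
  have hxN : x ≤ N := hx ▸ min_le_right _ _
  have hxN' : x' ≤ N' := hx' ▸ min_le_right _ _
  rcases h with ⟨h1, h2⟩ | ⟨h1, h2, h3, h4, h5⟩
  · exact ⟨⟨by omega, by omega⟩, .inl ⟨by omega, by omega⟩⟩
  have hD0 : (0 : ℝ) ≤ D := Nat.cast_nonneg _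
  have hdiv : ∀ (a b : ℝ) (i : Fin J), 0 < k.1 i → |a - b| ≤ D →
      ⌈a / (k.1 i : ℝ)⌉ ≤ ⌈b / (k.1 i : ℝ)⌉ + (D : ℤ) := by
    intro a b i hi hab
    have hk1 : (1 : ℝ) ≤ k.1 i := by exact_mod_cast hi
    rw [← Int.ceil_add_intCast]
    refine Int.ceil_mono ?_
    push_cast
    rw [div_add' _ _ _ (by linarith), div_le_div_iff_of_pos_right (by linarith)]
    have := abs_le.1 hab
    nlinarith
  have hc1 := (hmin j' hj').trans (hdiv _ _ j' hj' (h1 j'))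
  have hc2 := (hmin' j hj).trans (hdiv _ _ j hj (by rw [abs_sub_comm]; exact h1 j))
  have hxx : x ≤ x' + D ∧ x' ≤ x + D := by omega
  refine ⟨hxx, ?_⟩
  have hexp : D * (B + 2) = D * B + D + D := by ring
  have hcast : ((D * (B + 2) : ℕ) : ℝ) = D * B + D + D := by rw [hexp]; push_cast; ring
  have hDB : (0 : ℝ) ≤ D * B := by positivity
  -- if one of the iterations uses up its servers, then the other one has few servers left;
  -- otherwise both exhaust the types that they remove
  rcases eq_or_lt_of_le hxN with hNx | hNx
  · exact .inl ⟨by omega, by rw [hexp]; omega⟩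
  rcases eq_or_lt_of_le hxN' with hNx' | hNx'
  · exact .inl ⟨by rw [hexp]; omega, by omega⟩
  have hchg : ∀ i, |(x : ℝ) * (k.1 i : ℝ) - (x' : ℝ) * (k.1 i : ℝ)| ≤ (D : ℝ) * B := by
    intro i
    rw [← sub_mul, abs_mul]
    refine mul_le_mul ?_ ?_ (abs_nonneg _) hD0
    · have h6 : (x : ℝ) ≤ x' + D := by exact_mod_cast hxx.1
      have h7 : (x' : ℝ) ≤ x + D := by exact_mod_cast hxx.2
      rw [abs_le]; constructor <;> linarith
    · rw [Nat.abs_cast]; exact_mod_cast hB k i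
  have hexh : ∀ (q : ℝ) (y N₀ : ℕ) (i : Fin J), 0 < k.1 i →
      y = min (⌈q / (k.1 i : ℝ)⌉).toNat N₀ → y < N₀ → q - (y : ℝ) * (k.1 i : ℝ) ≤ 0 := by
    intro q y N₀ i hi hy hlt
    have h7 : ⌈q / (k.1 i : ℝ)⌉ ≤ (y : ℤ) := by omega
    have hle : q / (k.1 i : ℝ) ≤ y := by exact_mod_cast Int.ceil_le.1 h7
    rw [div_le_iff₀ (by exact_mod_cast hi)] at hle
    linarith
  have hdiff : ∀ i, |(r i - (x : ℝ) * (k.1 i : ℝ)) - (r' i - (x' : ℝ) * (k.1 i : ℝ))| ≤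
      ((D * (B + 2) : ℕ) : ℝ) := by
    intro i
    have h6 := abs_le.1 (h1 i)
    have h7 := abs_le.1 (hchg i)
    rw [hcast, abs_le]
    constructor <;> linarith
  refine .inr ⟨hdiff, by rw [hexp]; omega, by rw [hexp]; omega, fun i hi hi' => ?_,
    fun i hi hi' => ?_⟩
  · by_cases hiA : i ∈ A'
    · have hij : i = j' := by
        by_contra hne; exact hi' (Finset.mem_erase.2 ⟨hne, hiA⟩)
      subst hij
      have := hexh _ _ _ i hj' hx' hNx'
      have := abs_le.1 (hdiff i)
      linarith
    · have := h4 i (Finset.mem_of_mem_erase hi) hiA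
      have : (0 : ℝ) ≤ (x : ℝ) * (k.1 i : ℝ) := by positivity
      rw [hcast]; linarith
  · by_cases hiA : i ∈ A
    · have hij : i = j := by
        by_contra hne; exact hi' (Finset.mem_erase.2 ⟨hne, hiA⟩)
      subst hij
      have := hexh _ _ _ i hj hx hNx
      have := abs_le.1 (hdiff i)
      linarith
    · have := h5 i (Finset.mem_of_mem_erase hi) hiA
      have : (0 : ℝ) ≤ (x' : ℝ) * (k.1 i : ℝ) := by positivity
      rw [hcast]; linarith

/-- Stability of the greedy algorithm: runs from similar inputs have aligned outputs, no matter
how ties are broken. -/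
theorem GPARun.align {B : ℕ} (hB : ∀ (k : M.Config) (j : Fin J), k.1 j ≤ B) (n : ℕ) :
    ∀ (D : ℕ) (A A' : Finset (Fin J)) (r r' : Fin J → ℝ) (N N' : ℕ)
      (out out' : List (M.Config × ℕ)), A.card + A'.card ≤ n → GPARun M A r N out →
      GPARun M A' r' N' out' → Compat D A r N A' r' N' →
      Align (D * (B + 2) ^ n) out out' := by
  induction n with
  | zero =>
    intro D A A' r r' N N' out out' hn h h' hc
    have h1 := h.length_eq
    have h2 := h'.length_eq
    rw [List.eq_nil_of_length_eq_zero (by omega : out.length = 0),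
      List.eq_nil_of_length_eq_zero (by omega : out'.length = 0)]
    exact .nil
  | succ n ih =>
    -- a first step of one run that uses a type no longer available in the other run
    have skip : ∀ (D : ℕ) (A A' : Finset (Fin J)) (r r' : Fin J → ℝ) (N N' : ℕ)
        (k : M.Config) (j : Fin J) (x : ℕ) (out out' : List (M.Config × ℕ)),
        A.card + A'.card ≤ n + 1 → Compat D A r N A' r' N' → M.IsMaxReward A k → 0 < k.1 j →
        (∀ i, 0 < k.1 i → ⌈r j / (k.1 j : ℝ)⌉ ≤ ⌈r i / (k.1 i : ℝ)⌉) →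
        x = min (⌈r j / (k.1 j : ℝ)⌉).toNat N →
        GPARun M (A.erase j) (fun i => r i - (x : ℝ) * (k.1 i : ℝ)) (N - x) out →
        GPARun M A' r' N' out' → (∃ i ∈ A, i ∉ A' ∧ 0 < k.1 i) →
        Align (D * (B + 2) ^ (n + 1)) ((k, x) :: out) out' := by
      intro D A A' r r' N N' k j x out out' hn hc hk hj hmin hx hrest h' hi
      obtain ⟨hxD, hc'⟩ := hc.step_left hB hj hmin hx hi
      have hcard := Finset.card_erase_add_one (hk.mem_of_pos hj)
      have := ih _ _ _ _ _ _ _ _ _ (by omega) hrest h' hc'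
      rw [mul_assoc, ← pow_succ'] at this
      exact .left _ _ _ (hxD.trans (Nat.le_mul_of_pos_right _ (by positivity))) this
    intro D A A' r r' N N' out out' hn h h' hc
    cases h with
    | done =>
      cases h' with
      | done => exact .nil
      | step _ _ _ k' j' x' out' hA' hk' hj' hmin' hx' hrest' =>
        exact (skip _ _ _ _ _ _ _ _ _ _ _ _ (by omega) hc.symm hk' hj' hmin' hx' hrest'
          (.done _ _) ⟨j', hk'.mem_of_pos hj', by simp, hj'⟩).symm
    | step _ _ _ k j x out hA hk hj hmin hx hrest =>
      by_cases hi : ∃ i ∈ A, i ∉ A' ∧ 0 < k.1 i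
      · exact skip _ _ _ _ _ _ _ _ _ _ _ _ hn hc hk hj hmin hx hrest h' hi
      cases h' with
      | done => exact absurd ⟨j, hk.mem_of_pos hj, by simp, hj⟩ hi
      | step _ _ _ k' j' x' out' hA' hk' hj' hmin' hx' hrest' =>
        by_cases hi' : ∃ i ∈ A', i ∉ A ∧ 0 < k'.1 i
        · exact (skip _ _ _ _ _ _ _ _ _ _ _ _ (by omega) hc.symm hk' hj' hmin' hx' hrest'
            (.step A r N k j x out hA hk hj hmin hx hrest) hi').symm
        push Not at hi hi'
        obtain rfl : k = k' := hk.eq_of_support hk'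
          (fun i h1 h2 => by have := hi i h1 h2; omega)
          (fun i h1 h2 => by have := hi' i h1 h2; omega)
        obtain ⟨⟨h1, h2⟩, hc'⟩ := hc.step_both hB hj hj' hmin hmin' hx hx'
        have hcard := Finset.card_erase_add_one (hk.mem_of_pos hj)
        have hcard' := Finset.card_erase_add_one (hk'.mem_of_pos hj')
        have := ih _ _ _ _ _ _ _ _ _ (by omega) hrest hrest' hc'
        rw [mul_assoc, ← pow_succ'] at this
        have hD : D ≤ D * (B + 2) ^ (n + 1) := Nat.le_mul_of_pos_right _ (by positivity)
        exact .both _ _ _ _ _ (by omega) (by omega) this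

/-- Number of servers that the list `out` assigns to `k`. -/
noncomputable def assigned (out : List (M.Config × ℕ)) (k : M.Config) : ℕ :=
  ((out.filter fun p => decide (p.1 = k)).map fun p => p.2).sum

theorem assigned_cons (p : M.Config × ℕ) (out : List (M.Config × ℕ)) (k : M.Config) :
    assigned (p :: out) k = (if p.1 = k then p.2 else 0) + assigned out k := by
  unfold assigned
  by_cases h : p.1 = k <;> simp [h]

theorem Align.assigned_le {D : ℕ} {a b : List (M.Config × ℕ)} (h : Align D a b) (k : M.Config) :
    assigned a k ≤ assigned b k + D * a.length := by
  induction h with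
  | nil => simp
  | left p a b hp _ ih =>
    rw [assigned_cons, List.length_cons, mul_add]
    split_ifs <;> omega
  | right p a b hp _ ih =>
    rw [assigned_cons]
    omega
  | both k' x x' a b h1 h2 _ ih =>
    rw [assigned_cons, assigned_cons, List.length_cons, mul_add]
    dsimp only
    split_ifs <;> omega

theorem sum_assigned_mul (out : List (M.Config × ℕ)) (f : M.Config → ℝ) :
    ∑ k, (assigned out k : ℝ) * f k = (out.map fun p => (p.2 : ℝ) * f p.1).sum := by
  induction out with
  | nil => simp [assigned]
  | cons p out ih =>
    simp only [assigned_cons, Nat.cast_add, add_mul, Finset.sum_add_distrib, ih, List.map_cons,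
      List.sum_cons]
    simp

variable {L : ℕ}

/-! ### Reassignments caused by one event -/

namespace State

theorem idx_le_X (s : State M L) {l : Fin L} {k : M.Config} (h : s.cfg l = k) :
    s.idx l ≤ s.X k := h ▸ s.idx_le l

theorem ranked_iff (s : State M L) (q : M.Config × ℕ) (l : Fin L) :
    s.Ranked q l ↔ s.cfg l = q.1 ∧ s.X q.1 < s.idx l + q.2 := by
  have := s.idx_pos l
  unfold Ranked
  constructor <;> rintro ⟨h1, h2⟩ <;> exact ⟨h1, by omega⟩

theorem X_eq_sum (s : State M L) (k : M.Config) :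
    s.X k = ∑ l, if s.cfg l = k then 1 else 0 := by
  rw [X, Finset.card_filter]

theorem Reassigned.X_add {s s' : State M L} {l : Fin L} {k : M.Config}
    (h : s.Reassigned l k s') (q : M.Config) :
    s'.X q + (if s.cfg l = q then 1 else 0) = s.X q + (if k = q then 1 else 0) := by
  rw [X_eq_sum, X_eq_sum, ← Finset.add_sum_erase _ _ (Finset.mem_univ l),
    ← Finset.add_sum_erase (a := l) _ (fun m => if s.cfg m = q then 1 else 0) (Finset.mem_univ l)]
  have : ∑ m ∈ Finset.univ.erase l, (if s'.cfg m = q then 1 else 0) =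
      ∑ m ∈ Finset.univ.erase l, (if s.cfg m = q then 1 else 0) := by
    refine Finset.sum_congr rfl fun m hm => ?_
    rw [h.1, Function.update_of_ne (Finset.ne_of_mem_erase hm)]
  rw [this, h.1, Function.update_self]
  omega

/-- Outside the set `R` of servers, `c` has the same configurations as `s`, and no server has
more servers above it in the index order of its configuration than it has in `s`. -/
def Shift (R : Finset (Fin L)) (s c : State M L) : Prop :=
  ∀ m, m ∉ R → c.cfg m = s.cfg m ∧ c.X (s.cfg m) + s.idx m ≤ s.X (s.cfg m) + c.idx m

theorem Shift.refl (s : State M L) : Shift ∅ s s := fun _ _ => ⟨rfl, le_rfl⟩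

theorem Shift.trans {R R' : Finset (Fin L)} {s c d : State M L} (h : Shift R s c)
    (h' : Shift R' c d) : Shift (R ∪ R') s d := by
  intro m hm
  rw [Finset.mem_union, not_or] at hm
  obtain ⟨h1, h2⟩ := h m hm.1
  obtain ⟨h3, h4⟩ := h' m hm.2
  rw [h1] at h3 h4
  exact ⟨h3, by omega⟩

theorem Shift.ranked {R : Finset (Fin L)} {s c : State M L} (h : Shift R s c)
    {q : M.Config × ℕ} {m : Fin L} (hm : m ∉ R) (hr : s.Ranked q m) : c.Ranked q m := by
  rw [ranked_iff] at hr ⊢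
  obtain ⟨h1, h2⟩ := h m hm
  obtain ⟨h3, h4⟩ := hr
  rw [h3] at h1 h2
  exact ⟨h1, by omega⟩

theorem Shift.X_le {R : Finset (Fin L)} {s c : State M L} (h : Shift R s c) (k : M.Config) :
    c.X k ≤ s.X k + R.card ∧ s.X k ≤ c.X k + R.card := by
  classical
  constructor
  · refine (Finset.card_le_card (t := (Finset.univ.filter fun l => s.cfg l = k) ∪ R) ?_).trans
      (Finset.card_union_le _ _)
    intro l hl
    by_cases hlR : l ∈ R
    · exact Finset.mem_union_right _ hlR
    · refine Finset.mem_union_left _ ?_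
      simpa [← (h l hlR).1] using hl
  · refine (Finset.card_le_card (t := (Finset.univ.filter fun l => c.cfg l = k) ∪ R) ?_).trans
      (Finset.card_union_le _ _)
    intro l hl
    by_cases hlR : l ∈ R
    · exact Finset.mem_union_right _ hlR
    · refine Finset.mem_union_left _ ?_
      simpa [(h l hlR).1] using hl

/-- A reassigned server gets the lowest index of its new configuration, so that ranks of the other
servers can only be gained. -/
theorem Reassigned.shift {s s' : State M L} {l : Fin L} {k : M.Config}
    (h : s.Reassigned l k s') : Shift {l} s s' := by
  intro m hm
  rw [Finset.mem_singleton] at hm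
  have hcfg : s'.cfg m = s.cfg m := by rw [h.1, Function.update_of_ne hm]
  refine ⟨hcfg, ?_⟩
  have h1 := h.X_add (s.cfg m)
  have h2 := h.2.2.2 m hm
  by_cases e1 : s.cfg m = s.cfg l
  · rw [if_pos e1.symm] at h1
    by_cases e3 : s.cfg m = k
    · rw [if_pos e3.symm] at h1
      rw [if_pos e3] at h2
      split_ifs at h2 <;> omega
    · rw [if_neg (Ne.symm e3)] at h1
      rw [if_neg e3] at h2
      split_ifs at h2 <;> omega
  · rw [if_neg (Ne.symm e1)] at h1
    rw [if_neg (fun h => e1 h.1)] at h2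
    by_cases e3 : s.cfg m = k
    · rw [if_pos e3.symm] at h1
      rw [if_pos e3] at h2
      omega
    · rw [if_neg (Ne.symm e3)] at h1
      rw [if_neg e3] at h2
      omega

/-- Indices are distinct within a configuration. -/
theorem card_between (s : State M L) (k : M.Config) (a b : ℕ) (F : Finset (Fin L))
    (hF : ∀ l ∈ F, s.cfg l = k ∧ s.idx l + a ≤ s.X k ∧ s.X k < s.idx l + b) :
    F.card ≤ b - a := by
  rw [← Nat.card_Ico a b]
  refine Finset.card_le_card_of_injOn (fun l => s.X k - s.idx l) (fun l hl => ?_)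
    (fun l hl m hm hlm => ?_)
  · obtain ⟨h1, h2, h3⟩ := hF l hl
    have h4 := s.idx_le_X h1
    simp only [Finset.coe_Ico, Set.mem_Ico]
    omega
  · obtain ⟨h1, -, -⟩ := hF l hl
    obtain ⟨h2, -, -⟩ := hF m hm
    have h3 := s.idx_le_X h1
    have h4 := s.idx_le_X h2
    dsimp only at hlm
    exact s.idx_inj l m (h1.trans h2.symm) (by omega)

/-- What the reassignment algorithm achieves: for each entry of `out`, either it is matched, or
all empty servers are ranked for it or for earlier entries. -/
def Stable (s : State M L) (out : List (M.Config × ℕ)) : Prop :=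
  ∀ (pre : List (M.Config × ℕ)) (p : M.Config × ℕ) (post : List (M.Config × ℕ)),
    out = pre ++ p :: post →
      p.2 ≤ s.X p.1 ∨ ∀ l, s.IsEmpty l → ∃ q ∈ pre ++ [p], s.Ranked q l

theorem Stable.nil (s : State M L) : Stable s [] := by
  intro pre p post h
  simp at h

theorem Stable.snoc {s : State M L} {out : List (M.Config × ℕ)} {p : M.Config × ℕ}
    (h : Stable s out)
    (hp : p.2 ≤ s.X p.1 ∨ ∀ l, s.IsEmpty l → ∃ q ∈ out ++ [p], s.Ranked q l) :
    Stable s (out ++ [p]) := by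
  intro pre q post hq
  rcases List.eq_nil_or_concat post with rfl | ⟨post', p', rfl⟩
  · obtain ⟨rfl, h2⟩ := List.append_inj' hq rfl
    obtain rfl : p = q := by simpa using h2
    exact hp
  · rw [List.concat_eq_append, ← List.cons_append, ← List.append_assoc] at hq
    obtain ⟨h1, -⟩ := List.append_inj' hq rfl
    exact h pre q post' h1

/-- Reassigning an unranked empty server affects no matched entry, and no such server exists when
all empty servers are ranked. -/
theorem Stable.reassigned {s s' : State M L} {l : Fin L} {k : M.Config}
    {out : List (M.Config × ℕ)} (h : Stable s out) (hs : s.Reassigned l k s')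
    (hl : s.IsEmpty l) (hr : ∀ q ∈ out, ¬ s.Ranked q l) : Stable s' out := by
  intro pre p post hp
  rcases h pre p post hp with h1 | h1
  · refine .inl ?_
    have h2 := hr p (by simp [hp])
    rw [ranked_iff, not_and, not_lt] at h2
    have h3 := hs.X_add p.1
    by_cases h4 : s.cfg l = p.1
    · have := h2 h4
      have := s.idx_pos l
      rw [if_pos h4] at h3
      split_ifs at h3 <;> omega
    · rw [if_neg h4] at h3
      split_ifs at h3 <;> omega
  · obtain ⟨q, hq, hql⟩ := h1 l hl
    refine absurd hql (hr q ?_)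
    rw [hp]
    simp only [List.mem_append, List.mem_cons] at hq ⊢
    tauto

end State

open State

/-- The server that is reassigned to an unmatched entry was in another configuration. -/
theorem cfg_ne_of_not_ranked {s : State M L} {l : Fin L} {p : M.Config × ℕ}
    (hX : s.X p.1 < p.2) (hr : ¬ s.Ranked p l) : s.cfg l ≠ p.1 := by
  intro h
  refine hr ((s.ranked_iff p l).2 ⟨h, by omega⟩)

theorem CRAFill.plc_eq {done : List (M.Config × ℕ)} {p : M.Config × ℕ} {s s' : State M L}
    (h : CRAFill done p s s') : s'.plc = s.plc := by
  induction h with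
  | finish => rfl
  | step s s' s'' l hX hl hr hs hrest ih => rw [ih, hs.2.1]

theorem CRARun.plc_eq {done todo : List (M.Config × ℕ)} {s s' : State M L}
    (h : CRARun done todo s s') : s'.plc = s.plc := by
  induction h with
  | nil => rfl
  | cons done todo p s s' s'' hp hrest ih => rw [ih, hp.plc_eq]

/-- The servers reassigned for the entry `p` were empty and unranked, and at most as many as are
missing for `p`. -/
theorem CRAFill.exists_shift {done : List (M.Config × ℕ)} {p : M.Config × ℕ} {s s' : State M L}
    (hp : p ∈ done) (h : CRAFill done p s s') :
    ∃ R : Finset (Fin L), Shift R s s' ∧ R.card ≤ p.2 - s.X p.1 ∧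
      ∀ l ∈ R, s.IsEmpty l ∧ ∀ q ∈ done, ¬ s.Ranked q l := by
  induction h with
  | finish s h => exact ⟨∅, Shift.refl s, by simp, by simp⟩
  | step s s' s'' l hX hl hr hs hrest ih =>
    obtain ⟨R, hR, hcard, hE⟩ := ih
    -- each iteration brings `p` one server nearer to being matched
    have hne := cfg_ne_of_not_ranked hX (hr p hp)
    have hX' := hs.X_add p.1
    rw [if_neg hne, if_pos rfl] at hX'
    refine ⟨{l} ∪ R, hs.shift.trans hR, ?_, ?_⟩
    · refine (Finset.card_union_le _ _).trans ?_
      rw [Finset.card_singleton]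
      omega
    · intro m hm
      rw [Finset.mem_union, Finset.mem_singleton] at hm
      rcases hm with rfl | hm
      · exact ⟨hl, hr⟩
      -- the reassigned server `l` is ranked for `p` afterwards, so it is not reassigned again
      · obtain ⟨h1, h2⟩ := hE m hm
        have hml : m ≠ l := by
          rintro rfl
          refine h2 p hp ((s'.ranked_iff p m).2 ⟨by rw [hs.1, Function.update_self], ?_⟩)
          rw [hs.2.2.1]
          omega
        refine ⟨by simpa [State.IsEmpty, hs.2.1] using h1, fun q hq hrk => h2 q hq ?_⟩
        exact hs.shift.ranked (by simpa using hml) hrk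

theorem CRAFill.stable {done : List (M.Config × ℕ)} {p : M.Config × ℕ} {s s' : State M L}
    (h : CRAFill (done ++ [p]) p s s') (hs : Stable s done) : Stable s' (done ++ [p]) := by
  generalize hd : done ++ [p] = d at h
  induction h with
  | finish s h =>
    subst hd
    refine hs.snoc (h.imp id fun h => ?_)
    push Not at h
    exact h
  | step s s' s'' l hX hl hr hre hrest ih =>
    subst hd
    exact ih (hs.reassigned hre hl fun q hq => hr q (by simp [hq]))

theorem CRARun.stable {done todo : List (M.Config × ℕ)} {s s' : State M L}
    (h : CRARun done todo s s') (hs : Stable s done) : Stable s' (done ++ todo) := by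
  induction h with
  | nil => simpa using hs
  | cons done todo p s s' s'' hp hrest ih => simpa using ih (hp.stable hs)

/-- Servers that become available for reassignment, when the target assignment changes from a
list containing `pre` to one containing `pre'`, were ranked for an entry of `pre`; their number
is controlled by the changes of the entries. -/
theorem card_freed_le {D : ℕ} {pre pre' : List (M.Config × ℕ)}
    (hpre : ∀ q ∈ pre, q.2 ≤ D ∨ ∃ q' ∈ pre', q'.1 = q.1 ∧ q.2 ≤ q'.2 + D)
    {s c : State M L} {R F : Finset (Fin L)} {m₀ : Fin L}
    (hempty : ∀ l, l ≠ m₀ → c.IsEmpty l → s.IsEmpty l) (hR : Shift R s c)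
    (hs : ∀ l, s.IsEmpty l → ∃ q ∈ pre, s.Ranked q l)
    (hF : ∀ l ∈ F, c.IsEmpty l ∧ ∀ q ∈ pre', ¬ c.Ranked q l) :
    F.card ≤ R.card + 1 + pre.length * D := by
  classical
  let G : M.Config × ℕ → Finset (Fin L) := fun q => (F \ R).filter fun l => s.Ranked q l
  have hsub : F ⊆ (R ∪ {m₀}) ∪ pre.toFinset.biUnion G := by
    intro l hl
    by_cases hlR : l ∈ R
    · simp [hlR]
    by_cases hlm : l = m₀
    · simp [hlm]
    obtain ⟨q, hq, hql⟩ := hs l (hempty l hlm (hF l hl).1)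
    refine Finset.mem_union_right _ (Finset.mem_biUnion.2 ⟨q, by simpa using hq, ?_⟩)
    simp [G, hl, hlR, hql]
  have hG : ∀ q ∈ pre.toFinset, (G q).card ≤ D := by
    intro q hq
    rcases hpre q (by simpa using hq) with hqD | ⟨q', hq', hq1, hqD⟩
    · refine (s.card_between q.1 0 q.2 (G q) fun l hl => ?_).trans (by omega)
      have h1 := (Finset.mem_filter.1 hl).2
      rw [ranked_iff] at h1
      exact ⟨h1.1, s.idx_le_X h1.1, h1.2⟩
    · refine (c.card_between q.1 q'.2 q.2 (G q) fun l hl => ?_).trans (by omega)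
      obtain ⟨h1, h2⟩ := Finset.mem_filter.1 hl
      obtain ⟨h3, h4⟩ := Finset.mem_sdiff.1 h1
      have h5 := hR.ranked h4 h2
      have h6 := (hF l h3).2 q' hq'
      rw [ranked_iff] at h5 h6
      rw [hq1, not_and, not_lt] at h6
      exact ⟨h5.1, h6 h5.1, h5.2⟩
  calc F.card ≤ _ := Finset.card_le_card hsub
    _ ≤ (R ∪ {m₀}).card + (pre.toFinset.biUnion G).card := Finset.card_union_le _ _
    _ ≤ (R.card + 1) + pre.toFinset.card * D := by
        refine Nat.add_le_add ((Finset.card_union_le _ _).trans (by simp)) ?_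
        exact Finset.card_biUnion_le_card_mul _ _ _ hG
    _ ≤ R.card + 1 + pre.length * D := by
        gcongr
        exact List.toFinset_card_le _

/-- Rerunning the reassignment algorithm at a state that was stable for an aligned target, up to
one server that may have become empty, moves a bounded number of servers. -/
theorem Align.exists_shift {D : ℕ} {a b : List (M.Config × ℕ)} (h : Align D a b) {s : State M L}
    {m₀ : Fin L} : ∀ (pre pre' : List (M.Config × ℕ)) (c c' : State M L) (R : Finset (Fin L)),
      Stable s (pre ++ a) →
      (∀ q ∈ pre, q.2 ≤ D ∨ ∃ q' ∈ pre', q'.1 = q.1 ∧ q.2 ≤ q'.2 + D) →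
      (∀ l, l ≠ m₀ → c.IsEmpty l → s.IsEmpty l) → Shift R s c → CRARun pre' b c c' →
      ∃ R' : Finset (Fin L), Shift R' s c' ∧
        R'.card + 1 + ((pre ++ a).length + 1) * D ≤
          2 ^ b.length * (R.card + 1 + ((pre ++ a).length + 1) * D) := by
  induction h with
  | nil =>
    intro pre pre' c c' R hs hpre hempty hR hrun
    cases hrun
    exact ⟨R, hR, by simp⟩
  | left p a b hp h ih =>
    intro pre pre' c c' R hs hpre hempty hR hrun
    have := ih (pre ++ [p]) pre' c c' R (by simpa using hs) (fun q hq => ?_) hempty hR hrun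
    · simpa using this
    · rw [List.mem_append, List.mem_singleton] at hq
      rcases hq with hq | rfl
      · exact hpre q hq
      · exact .inl hp
  | right p a b hp h ih =>
    intro pre pre' c c' R hs hpre hempty hR hrun
    cases hrun with
    | cons _ _ _ _ c₁ _ hfill hrest =>
    obtain ⟨F, hF, hcard, -⟩ := hfill.exists_shift (by simp)
    have hpre₁ : ∀ q ∈ pre, q.2 ≤ D ∨ ∃ q' ∈ pre' ++ [p], q'.1 = q.1 ∧ q.2 ≤ q'.2 + D := by
      intro q hq
      rcases hpre q hq with h1 | ⟨q', h1, h2⟩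
      · exact .inl h1
      · exact .inr ⟨q', by simp [h1], h2⟩
    obtain ⟨R', hR', hle⟩ := ih pre (pre' ++ [p]) c₁ c' (R ∪ F) hs hpre₁
      (fun l hl hle => hempty l hl (by simpa [State.IsEmpty, hfill.plc_eq] using hle))
      (hR.trans hF) hrest
    refine ⟨R', hR', hle.trans ?_⟩
    rw [List.length_cons, pow_succ, mul_assoc]
    refine Nat.mul_le_mul_left _ ?_
    have := Finset.card_union_le R F
    have : F.card ≤ D := by omega
    rw [add_mul]
    omega
  | both k x x' a b h1 h2 h ih =>
    intro pre pre' c c' R hs hpre hempty hR hrun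
    cases hrun with
    | cons _ _ _ _ c₁ _ hfill hrest =>
    obtain ⟨F, hF, hcard, hFE⟩ := hfill.exists_shift (by simp)
    have hpre₁ : ∀ q ∈ pre ++ [(k, x)], q.2 ≤ D ∨
        ∃ q' ∈ pre' ++ [(k, x')], q'.1 = q.1 ∧ q.2 ≤ q'.2 + D := by
      intro q hq
      rw [List.mem_append, List.mem_singleton] at hq
      rcases hq with hq | rfl
      · rcases hpre q hq with h3 | ⟨q', h3, h4⟩
        · exact .inl h3
        · exact .inr ⟨q', by simp [h3], h4⟩
      · exact .inr ⟨(k, x'), by simp, rfl, h1⟩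
    have hFcard : F.card ≤ R.card + 1 + ((pre ++ (k, x) :: a).length + 1) * D := by
      -- a matched entry lacks few servers, an unmatched one finds few available servers
      rcases hs pre (k, x) a rfl with h3 | h3
      · have := (hR.X_le k).2
        dsimp only at h3 hcard
        rw [add_mul]
        omega
      · refine (card_freed_le hpre₁ hempty hR h3 hFE).trans ?_
        gcongr
        simp
    obtain ⟨R', hR', hle⟩ := ih (pre ++ [(k, x)]) (pre' ++ [(k, x')]) c₁ c' (R ∪ F)
      (by simpa using hs) hpre₁
      (fun l hl hle => hempty l hl (by simpa [State.IsEmpty, hfill.plc_eq] using hle))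
      (hR.trans hF) hrest
    rw [List.append_assoc, List.singleton_append] at hle
    refine ⟨R', hR', hle.trans ?_⟩
    rw [List.length_cons, pow_succ, mul_assoc]
    refine Nat.mul_le_mul_left _ ?_
    have := Finset.card_union_le R F
    omega

/-! ### Jumps of the scaled state -/

theorem State.JobAdded.Y_eq {s s' : State M L} {l : Fin L} {j : Fin J} (h : s.JobAdded l j s')
    (i : Fin J) : s'.Y i = s.Y i + if i = j then 1 else 0 := by
  unfold State.Y
  rw [← Finset.add_sum_erase _ _ (Finset.mem_univ l),
    ← Finset.add_sum_erase (a := l) _ (fun m => s.plc m i) (Finset.mem_univ l)]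
  have : ∑ m ∈ Finset.univ.erase l, s'.plc m i = ∑ m ∈ Finset.univ.erase l, s.plc m i := by
    refine Finset.sum_congr rfl fun m hm => ?_
    rw [h.2.2, Function.update_of_ne (Finset.ne_of_mem_erase hm)]
  rw [this, h.2.2, Function.update_self, Pi.add_apply, Pi.single_apply]
  omega

theorem State.JobAdded.X_eq {s s' : State M L} {l : Fin L} {j : Fin J} (h : s.JobAdded l j s')
    (k : M.Config) : s'.X k = s.X k := by
  unfold State.X
  rw [h.1]

variable {γ : ℝ}

theorem Rule.Xhat_eq_assigned (R : Rule M L γ) (s : State M L) (k : M.Config) :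
    R.Xhat s k = assigned (R.gpa (workloadRef γ s)) k := rfl

/-- The states in which the reassignment algorithm has nothing to do. -/
def Rule.stableStates (R : Rule M L γ) : Set (State M L) :=
  {s | s.Stable (R.gpa (workloadRef γ s))}

theorem CRA.mem_stableStates (R : Rule M L γ) {s s' : State M L} (h : CRA γ R.gpa s s') :
    s' ∈ R.stableStates := by
  have h1 := CRARun.stable h (Stable.nil s)
  have h2 := CRARun.plc_eq h
  have h3 : workloadRef γ s' = workloadRef γ s := by
    funext j
    simp only [workloadRef, State.Y, h2]
  show s'.Stable _
  rw [h3]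
  simpa using h1

/-- The number of servers that one event can move. -/
def jumpBound (J B : ℕ) : ℕ :=
  2 ^ J * (1 + (J + 1) * (B + 2) ^ (J + J)) + (B + 2) ^ (J + J) * J + 1

/-- From a stable state, an event that adds or removes one job changes every coordinate of the
unscaled effective state by a bounded amount. -/
theorem Rule.close_of_event {B : ℕ} (hB : ∀ (k : M.Config) (j : Fin J), k.1 j ≤ B)
    (R : Rule M L γ) {s s₁ s' : State M L} {m₀ : Fin L} {j : Fin J} (hs : s ∈ R.stableStates)
    (h : s.JobAdded m₀ j s₁ ∨ s.JobRemoved m₀ j s₁) (h' : CRA γ R.gpa s₁ s') :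
    (∀ i, |(s.Y i : ℝ) - s'.Y i| ≤ jumpBound J B) ∧
      ∀ k, |(R.Xeff s k : ℝ) - R.Xeff s' k| ≤ jumpBound J B := by
  have hY' : ∀ i, s'.Y i = s₁.Y i := fun i => by
    simp only [State.Y, CRARun.plc_eq h']
  have hY : ∀ i, |(s.Y i : ℝ) - s'.Y i| ≤ 1 := by
    intro i
    rw [hY' i]
    rcases h with h | h
    · rw [JobAdded.Y_eq h i]; split_ifs <;> simp
    · rw [JobAdded.Y_eq h i]; split_ifs <;> simp
  have hw : workloadRef γ s' = workloadRef γ s₁ := by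
    funext i; simp only [workloadRef, hY' i]
  set out := R.gpa (workloadRef γ s) with hout
  set out' := R.gpa (workloadRef γ s₁) with hout'
  have hlen : out.length = J := by
    have := (R.gpa_spec (workloadRef γ s)).length_eq
    simpa using this
  have hlen' : out'.length = J := by
    have := (R.gpa_spec (workloadRef γ s₁)).length_eq
    simpa using this
  set D := (B + 2) ^ (J + J) with hD
  have halign : Align D out out' := by
    have := GPARun.align hB (J + J) 1 Finset.univ Finset.univ _ _ _ _ _ _ (by simp)
      (R.gpa_spec (workloadRef γ s)) (R.gpa_spec (workloadRef γ s₁))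
      (.inr ⟨fun i => by
        have := hY i
        rw [hY' i] at this
        simpa [workloadRef] using this, by omega, by omega, by simp, by simp⟩)
    simpa using this
  have hempty : ∀ l, l ≠ m₀ → s₁.IsEmpty l → s.IsEmpty l := by
    intro l hl hle
    rcases h with h | h
    · have : s₁.plc l = s.plc l := by rw [h.2.2, Function.update_of_ne hl]
      rwa [State.IsEmpty, ← this]
    · have : s.plc l = s₁.plc l := by rw [h.2.2, Function.update_of_ne hl]
      rwa [State.IsEmpty, this]
  have hshift : Shift ∅ s s₁ := by
    intro m _
    rcases h with h | h
    · rw [JobAdded.X_eq h, h.1, h.2.1]; exact ⟨rfl, le_rfl⟩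
    · rw [← JobAdded.X_eq h, ← h.1, ← h.2.1]; exact ⟨rfl, le_rfl⟩
  obtain ⟨F, hF, hcard⟩ := halign.exists_shift (m₀ := m₀) [] [] s₁ s' ∅ hs (by simp) hempty
    hshift h'
  simp only [List.nil_append, hlen, hlen', Finset.card_empty, zero_add] at hcard
  have hbound : jumpBound J B = 2 ^ J * (1 + (J + 1) * D) + D * J + 1 := rfl
  refine ⟨fun i => (hY i).trans ?_, fun k => ?_⟩
  · rw [hbound]; push_cast
    have : (0 : ℝ) ≤ 2 ^ J * (1 + (J + 1) * D) + D * J := by positivity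
    linarith
  · have h1 := hF.X_le k
    have h2 := halign.assigned_le k
    have h3 := halign.symm.assigned_le k
    rw [hlen] at h2
    rw [hlen'] at h3
    have h4 : R.Xeff s k = min (s.X k) (assigned out k) := rfl
    have h5 : R.Xeff s' k = min (s'.X k) (assigned out' k) := by
      rw [Rule.Xeff, Rule.Xhat_eq_assigned, hw]
    have h6 : R.Xeff s k ≤ R.Xeff s' k + jumpBound J B ∧
        R.Xeff s' k ≤ R.Xeff s k + jumpBound J B := by
      rw [h4, h5, hbound]
      omega
    have h7 : (R.Xeff s k : ℝ) ≤ R.Xeff s' k + jumpBound J B := by exact_mod_cast h6.1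
    have h8 : (R.Xeff s' k : ℝ) ≤ R.Xeff s k + jumpBound J B := by exact_mod_cast h6.2
    rw [abs_le]
    constructor <;> linarith

/-- The scaled state without the scaling. -/
noncomputable def Rule.unscaled (R : Rule M L γ) (s : State M L) :
    (M.GreedyConfig → ℝ) × (Fin J → ℝ) := (L : ℝ) • R.scaled s

theorem Rule.unscaled_eq (hL : L ≠ 0) (R : Rule M L γ) (s : State M L) :
    R.unscaled s = (fun k => (R.Xeff s k.1 : ℝ), fun j => (s.Y j : ℝ)) := by
  have hL' : (L : ℝ) ≠ 0 := by exact_mod_cast hL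
  ext i
  · simp [unscaled, scaled, mul_div_cancel₀ _ hL']
  · simp [unscaled, scaled, mul_div_cancel₀ _ hL']

theorem Rule.dist_unscaled_le {B : ℕ} (hB : ∀ (k : M.Config) (j : Fin J), k.1 j ≤ B)
    (R : Rule M L γ) {s s₁ s' : State M L} {m₀ : Fin L} {j : Fin J} (hs : s ∈ R.stableStates)
    (h : s.JobAdded m₀ j s₁ ∨ s.JobRemoved m₀ j s₁) (h' : CRA γ R.gpa s₁ s') :
    dist (R.unscaled s) (R.unscaled s') ≤ jumpBound J B := by
  have hL : L ≠ 0 := fun h0 => by subst h0; exact m₀.elim0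
  obtain ⟨h1, h2⟩ := R.close_of_event hB hs h h'
  rw [R.unscaled_eq hL, R.unscaled_eq hL, Prod.dist_eq]
  refine max_le ?_ ?_
  · exact (dist_pi_le_iff (Nat.cast_nonneg _)).2 fun k => by rw [Real.dist_eq]; exact h2 k.1
  · exact (dist_pi_le_iff (Nat.cast_nonneg _)).2 fun i => by rw [Real.dist_eq]; exact h1 i

theorem Rule.arr_support_spec {B : ℕ} (hB : ∀ (k : M.Config) (j : Fin J), k.1 j ≤ B)
    (R : Rule M L γ) {s s' : State M L} {j : Fin J} (hs : s ∈ R.stableStates)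
    (h : s' ∈ (R.arr s j).support) :
    s' ∈ R.stableStates ∧ dist (R.unscaled s) (R.unscaled s') ≤ jumpBound J B := by
  rcases R.arr_spec s j s' h with ⟨l, -, -, s₁, h1, h2⟩ | ⟨-, rfl⟩
  · exact ⟨CRA.mem_stableStates R h2, R.dist_unscaled_le hB hs (.inl h1) h2⟩
  · exact ⟨hs, by simp⟩

theorem Rule.dep_support_spec {B : ℕ} (hB : ∀ (k : M.Config) (j : Fin J), k.1 j ≤ B)
    (R : Rule M L γ) {s s' : State M L} {l : Fin L} {j : Fin J} (hs : s ∈ R.stableStates)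
    (hl : 0 < s.plc l j) (h : s' ∈ (R.dep s l j).support) :
    s' ∈ R.stableStates ∧ dist (R.unscaled s) (R.unscaled s') ≤ jumpBound J B := by
  rcases R.dep_spec s l j hl s' h with ⟨m, -, -, -, -, s₁, h1, h2⟩ | ⟨-, s₁, h1, h2⟩
  · exact ⟨CRA.mem_stableStates R h2, R.dist_unscaled_le hB hs (.inr h1) h2⟩
  · exact ⟨CRA.mem_stableStates R h2, R.dist_unscaled_le hB hs (.inr h1) h2⟩

/-! ### The space of fluid states -/

theorem CloudModel.isClosed_Lambda (M : CloudModel J) : IsClosed M.Lambda := by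
  refine IsSeqClosed.isClosed fun y y₀ hy hlim => ?_
  choose x hx0 hx1 hxy using hy
  obtain ⟨x₀, hx₀, φ, hφ, hxlim⟩ := (isCompact_stdSimplex ℝ M.Config).tendsto_subseq
    (fun n => (⟨hx0 n, hx1 n⟩ : x n ∈ stdSimplex ℝ M.Config))
  refine ⟨x₀, hx₀.1, hx₀.2, fun j => ?_⟩
  refine le_of_tendsto_of_tendsto' (((continuous_apply j).tendsto _).comp
    (hlim.comp hφ.tendsto_atTop)) ?_ (fun n => hxy (φ n) j)
  refine tendsto_finsetSum _ fun k _ => ?_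
  exact (((continuous_apply k).tendsto _).comp hxlim).mul_const _

theorem sum_greedyConfig_le {f : M.Config → ℝ} (hf : ∀ k, 0 ≤ f k) :
    ∑ k : M.GreedyConfig, f k.1 ≤ ∑ k, f k := by
  have h := Finset.sum_map (Finset.univ : Finset M.GreedyConfig)
    ⟨Subtype.val, Subtype.val_injective⟩ f
  exact h.symm.le.trans (Finset.sum_le_univ_sum_of_nonneg hf)

theorem State.scaled_Y_mem_Lambda (hL : L ≠ 0) (s : State M L) :
    (fun j => (s.Y j : ℝ) / L) ∈ M.Lambda := by
  have hL' : (0 : ℝ) < L := by exact_mod_cast Nat.pos_of_ne_zero hL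
  refine ⟨fun k => (s.X k : ℝ) / L, fun k => by positivity, ?_, fun j => ?_⟩
  · rw [← Finset.sum_div, div_eq_one_iff_eq hL'.ne']
    have : ∑ k, s.X k = L := by
      have := Finset.card_eq_sum_card_fiberwise (f := s.cfg) (s := Finset.univ)
        (t := Finset.univ) (fun _ _ => by simp)
      rw [Finset.card_univ, Fintype.card_fin] at this
      exact this.symm
    exact_mod_cast this
  · have h1 : ∀ k, (s.X k : ℝ) / L * (k.1 j : ℝ) =
        (∑ l, if s.cfg l = k then (k.1 j : ℝ) else 0) / L := by
      intro k
      rw [← Finset.sum_filter, Finset.sum_const, nsmul_eq_mul, State.X]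
      ring
    simp only [h1]
    rw [← Finset.sum_div, div_le_div_iff_of_pos_right hL', Finset.sum_comm]
    simp only [Finset.sum_ite_eq, Finset.mem_univ, if_true, State.Y]
    exact_mod_cast Finset.sum_le_sum fun l _ => s.plc_le l j

theorem Rule.sum_Xeff_mul_le (R : Rule M L γ) (s : State M L) {f : M.Config → ℝ}
    (hf : ∀ k, 0 ≤ f k) : ∑ k : M.GreedyConfig, (R.Xeff s k.1 : ℝ) * f k.1 ≤
      ((R.gpa (workloadRef γ s)).map fun p => (p.2 : ℝ) * f p.1).sum := by
  rw [← sum_assigned_mul]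
  refine (sum_greedyConfig_le (f := fun k => (R.Xeff s k : ℝ) * f k)
    fun k => mul_nonneg (Nat.cast_nonneg _) (hf k)).trans (Finset.sum_le_sum fun k _ => ?_)
  refine mul_le_mul_of_nonneg_right ?_ (hf k)
  exact_mod_cast min_le_right _ _

theorem Rule.sum_scaled_le_one (R : Rule M L γ) (s : State M L) :
    ∑ k, (R.scaled s).1 k ≤ 1 := by
  have h := R.sum_Xeff_mul_le s (f := fun _ => 1) (fun _ => zero_le_one)
  simp only [mul_one] at h
  have h1 := (R.gpa_spec (workloadRef γ s)).sum_le
  have h2 : (((R.gpa (workloadRef γ s)).map fun p => (p.2 : ℝ)).sum) ≤ L := by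
    have : ((((R.gpa (workloadRef γ s)).map fun p => p.2).sum : ℕ) : ℝ) ≤ L := by
      exact_mod_cast h1
    rwa [Nat.cast_list_sum, List.map_map] at this
  show ∑ k : M.GreedyConfig, (R.Xeff s k.1 : ℝ) / (L : ℝ) ≤ 1
  rw [← Finset.sum_div]
  exact div_le_one_of_le₀ (h.trans h2) (Nat.cast_nonneg _)

theorem Rule.scaled_nonneg (R : Rule M L γ) (s : State M L) (k : M.GreedyConfig) :
    0 ≤ (R.scaled s).1 k := by
  show 0 ≤ (R.Xeff s k.1 : ℝ) / (L : ℝ)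
  positivity

theorem Rule.sum_scaled_mul_le {B : ℕ} (hB : ∀ (k : M.Config) (j : Fin J), k.1 j ≤ B)
    (hγ : 0 ≤ γ) (R : Rule M L γ) (s : State M L) (j : Fin J) :
    ∑ k, (R.scaled s).1 k * (k.1.1 j : ℝ) ≤ (R.scaled s).2 j + (γ + B) / L := by
  have h := R.sum_Xeff_mul_le s (f := fun k => (k.1 j : ℝ)) (fun _ => Nat.cast_nonneg _)
  have h1 := (R.gpa_spec (workloadRef γ s)).sum_mul_le hB j (by
    have : (0 : ℝ) ≤ s.Y j := Nat.cast_nonneg _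
    have : (0 : ℝ) ≤ B := Nat.cast_nonneg _
    simp only [workloadRef]
    linarith)
  have h2 : ∑ k, (R.scaled s).1 k * (k.1.1 j : ℝ) =
      (∑ k : M.GreedyConfig, (R.Xeff s k.1 : ℝ) * (k.1.1 j : ℝ)) / L := by
    rw [Finset.sum_div]
    exact Finset.sum_congr rfl fun k _ => div_mul_eq_mul_div _ _ _
  have h3 : (R.scaled s).2 j = (s.Y j : ℝ) / L := rfl
  rw [h2, h3, ← add_div]
  refine div_le_div_of_nonneg_right ?_ (Nat.cast_nonneg _)
  simp only [workloadRef] at h h1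
  linarith

theorem State.Y_le {B : ℕ} (hB : ∀ (k : M.Config) (j : Fin J), k.1 j ≤ B) (s : State M L)
    (j : Fin J) : s.Y j ≤ L * B := by
  refine (Finset.sum_le_card_nsmul _ _ B fun l _ => (s.plc_le l j).trans (hB _ j)).trans ?_
  simp

theorem Rule.scaled_mem_closedBall {B : ℕ} (hB0 : 0 < B)
    (hB : ∀ (k : M.Config) (j : Fin J), k.1 j ≤ B)
    (R : Rule M L γ) (s : State M L) : R.scaled s ∈ Metric.closedBall 0 (B : ℝ) := by
  have hB1 : (1 : ℝ) ≤ B := by exact_mod_cast hB0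
  rw [Metric.mem_closedBall, Prod.dist_eq]
  refine max_le ((dist_pi_le_iff (by positivity)).2 fun k => ?_)
    ((dist_pi_le_iff (by positivity)).2 fun j => ?_)
  · have h1 := R.scaled_nonneg s k
    have h2 := Finset.single_le_sum (fun k _ => R.scaled_nonneg s k) (Finset.mem_univ k)
    have h3 := R.sum_scaled_le_one s
    rw [Real.dist_eq]
    simp only [Prod.fst_zero, Pi.zero_apply, sub_zero]
    rw [abs_of_nonneg h1]
    linarith
  · rw [Real.dist_eq]
    simp only [Prod.snd_zero, Pi.zero_apply, sub_zero]
    have h3 : (R.scaled s).2 j = (s.Y j : ℝ) / L := rfl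
    rw [h3, abs_of_nonneg (by positivity)]
    refine div_le_of_le_mul₀ (Nat.cast_nonneg _) (Nat.cast_nonneg _) ?_
    rw [mul_comm]
    exact_mod_cast s.Y_le hB j

/-- Limits of scaled states are fluid states; this uses that the reservation is `o(L)`. -/
theorem mem_Z_of_tendsto {L : ℕ → ℕ} {γ : ℕ → ℝ} (hγ : ∀ n, 0 ≤ γ n)
    (hL : Tendsto L atTop atTop) (hγL : Tendsto (fun n => γ n / (L n : ℝ)) atTop (𝓝 0))
    (R : ∀ n, Rule M (L n) (γ n)) (s : ∀ n, State M (L n))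
    {z : (M.GreedyConfig → ℝ) × (Fin J → ℝ)}
    (hz : Tendsto (fun n => (R n).scaled (s n)) atTop (𝓝 z)) : z ∈ M.Z := by
  obtain ⟨B, -, hB⟩ := M.exists_slot_bound
  have h1 : ∀ k, Tendsto (fun n => ((R n).scaled (s n)).1 k) atTop (𝓝 (z.1 k)) := fun k =>
    ((continuous_apply k).comp continuous_fst).continuousAt.tendsto.comp hz
  have h2 : ∀ j, Tendsto (fun n => ((R n).scaled (s n)).2 j) atTop (𝓝 (z.2 j)) := fun j =>
    ((continuous_apply j).comp continuous_snd).continuousAt.tendsto.comp hz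
  refine ⟨?_, fun k => ?_, ?_, fun j => ?_⟩
  · refine M.isClosed_Lambda.mem_of_tendsto ((continuous_snd.tendsto _).comp hz) ?_
    filter_upwards [hL.eventually_ne_atTop 0] with n hn
    exact State.scaled_Y_mem_Lambda hn (s n)
  · exact ge_of_tendsto' (h1 k) fun n => (R n).scaled_nonneg (s n) k
  · exact le_of_tendsto' (tendsto_finsetSum _ fun k _ => h1 k) fun n =>
      (R n).sum_scaled_le_one (s n)
  · have h3 : Tendsto (fun n => ((R n).scaled (s n)).2 j + (γ n + B) / (L n : ℝ)) atTop
        (𝓝 (z.2 j + 0)) := by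
      refine (h2 j).add ?_
      have h4 : Tendsto (fun n => γ n / (L n : ℝ) + (B : ℝ) / (L n : ℝ)) atTop (𝓝 (0 + 0)) :=
        hγL.add (tendsto_const_nhds.div_atTop (tendsto_natCast_atTop_atTop.comp hL))
      rw [add_zero] at h4
      exact h4.congr fun n => (add_div _ _ _).symm
    rw [add_zero] at h3
    exact le_of_tendsto_of_tendsto' (tendsto_finsetSum _ fun k _ => (h1 k).mul_const _) h3
      fun n => (R n).sum_scaled_mul_le hB (hγ n) (s n) j

/-! ### The transition rates -/

theorem pmf_sum_toReal_eq_one {E : Type*} [Fintype E] (p : PMF E) :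
    ∑ b, (p b).toReal = 1 := by
  have h := p.tsum_coe
  rw [tsum_fintype] at h
  rw [← ENNReal.toReal_sum fun b _ => p.apply_ne_top b, h, ENNReal.toReal_one]

theorem pmf_sum_toReal_mul_le {E : Type*} [Fintype E] (p : PMF E) {f : E → ℝ} {C : ℝ}
    (hf : ∀ b ∈ p.support, f b ≤ C) : ∑ b, (p b).toReal * f b ≤ C := by
  calc ∑ b, (p b).toReal * f b ≤ ∑ b, (p b).toReal * C := by
        refine Finset.sum_le_sum fun b _ => ?_
        by_cases hb : b ∈ p.support
        · exact mul_le_mul_of_nonneg_left (hf b hb) ENNReal.toReal_nonneg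
        · rw [PMF.mem_support_iff, not_not] at hb
          simp [hb]
    _ = C := by rw [← Finset.sum_mul, pmf_sum_toReal_eq_one, one_mul]

/-- A bound, per server, for the total rate of events. -/
noncomputable def CloudModel.rateBound (M : CloudModel J) (B : ℕ) : ℝ :=
  ∑ j, M.lam j + B * ∑ j, M.mu j

theorem CloudModel.rateBound_nonneg (M : CloudModel J) (B : ℕ) : 0 ≤ M.rateBound B :=
  add_nonneg (Finset.sum_nonneg fun j _ => (M.lam_pos j).le)
    (mul_nonneg (Nat.cast_nonneg _) (Finset.sum_nonneg fun j _ => (M.mu_pos j).le))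

theorem Rule.generator_nonneg (R : Rule M L γ) {a b : State M L} (hab : b ≠ a) :
    0 ≤ R.generator a b := by
  simp only [generator, if_neg hab, sub_zero]
  refine add_nonneg (Finset.sum_nonneg fun j _ => ?_)
    (Finset.sum_nonneg fun l _ => Finset.sum_nonneg fun j _ => ?_)
  · have := (M.lam_pos j).le
    positivity
  · have := (M.mu_pos j).le
    positivity

theorem Rule.generator_eq_zero (R : Rule M L γ) {a b : State M L} (ha : a ∈ R.stableStates)
    (hb : b ∉ R.stableStates) : R.generator a b = 0 := by
  obtain ⟨B, -, hB⟩ := M.exists_slot_bound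
  have hab : b ≠ a := fun h => hb (h ▸ ha)
  simp only [generator, if_neg hab, sub_zero]
  have h1 : ∀ j, R.arr a j b = 0 := fun j => by
    by_contra h
    exact hb (R.arr_support_spec hB ha ((PMF.mem_support_iff _ _).2 h)).1
  have h2 : ∀ l j, M.mu j * (a.plc l j : ℝ) * (R.dep a l j b).toReal = 0 := fun l j => by
    rcases Nat.eq_zero_or_pos (a.plc l j) with h0 | hpos
    · simp [h0]
    · have : R.dep a l j b = 0 := by
        by_contra h
        exact hb (R.dep_support_spec hB ha hpos ((PMF.mem_support_iff _ _).2 h)).1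
      simp [this]
  simp [h1, h2]

/-- The exponential moment of the jumps of the unscaled state, weighted by their rates. -/
theorem Rule.sum_generator_mul_exp_le {B : ℕ} (hB : ∀ (k : M.Config) (j : Fin J), k.1 j ≤ B)
    (R : Rule M L γ) {a : State M L} (ha : a ∈ R.stableStates) :
    ∑ b, R.generator a b * Real.exp (dist (R.unscaled a) (R.unscaled b)) ≤
      M.rateBound B * Real.exp (jumpBound J B) * L := by
  set f : State M L → ℝ := fun b => Real.exp (dist (R.unscaled a) (R.unscaled b)) with hf
  set E := Real.exp (jumpBound J B) with hE
  have hE0 : 0 < E := Real.exp_pos _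
  have hsub : ∀ p : PMF (State M L), (∀ b ∈ p.support, f b ≤ E) →
      ∑ b, ((p b).toReal - if b = a then 1 else 0) * f b ≤ E := by
    intro p hp
    have h1 := pmf_sum_toReal_mul_le p hp
    have h2 : ∑ b, (if b = a then (1 : ℝ) else 0) * f b = f a := by simp
    simp only [sub_mul, Finset.sum_sub_distrib, h2]
    have : 0 < f a := Real.exp_pos _
    linarith
  have harr : ∀ j, ∑ b, ((R.arr a j b).toReal - if b = a then 1 else 0) * f b ≤ E := fun j =>
    hsub _ fun b hb => Real.exp_le_exp.2 (R.arr_support_spec hB ha hb).2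
  have hdep : ∀ l j, (a.plc l j : ℝ) *
      ∑ b, ((R.dep a l j b).toReal - if b = a then 1 else 0) * f b ≤ B * E := by
    intro l j
    rcases Nat.eq_zero_or_pos (a.plc l j) with h0 | hpos
    · rw [h0]; simp; positivity
    · have h1 := hsub (R.dep a l j) fun b hb =>
        Real.exp_le_exp.2 (R.dep_support_spec hB ha hpos hb).2
      have h2 : (a.plc l j : ℝ) ≤ B := by exact_mod_cast (a.plc_le l j).trans (hB _ j)
      calc (a.plc l j : ℝ) * _ ≤ (a.plc l j : ℝ) * E :=
            mul_le_mul_of_nonneg_left h1 (Nat.cast_nonneg _)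
        _ ≤ B * E := mul_le_mul_of_nonneg_right h2 hE0.le
  have hexp : ∑ b, R.generator a b * f b =
      (∑ j, M.lam j * (L : ℝ) * ∑ b, ((R.arr a j b).toReal - if b = a then 1 else 0) * f b) +
      ∑ l, ∑ j, M.mu j * ((a.plc l j : ℝ) *
        ∑ b, ((R.dep a l j b).toReal - if b = a then 1 else 0) * f b) := by
    simp only [generator, add_mul, Finset.sum_add_distrib, Finset.sum_mul, Finset.mul_sum]
    congr 1
    · rw [Finset.sum_comm]
      exact Finset.sum_congr rfl fun j _ => Finset.sum_congr rfl fun b _ => by ring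
    · rw [Finset.sum_comm]
      refine Finset.sum_congr rfl fun l _ => ?_
      rw [Finset.sum_comm]
      exact Finset.sum_congr rfl fun j _ => Finset.sum_congr rfl fun b _ => by ring
  rw [hexp]
  have h1 : ∑ j, M.lam j * (L : ℝ) *
      ∑ b, ((R.arr a j b).toReal - if b = a then 1 else 0) * f b ≤ (∑ j, M.lam j) * L * E := by
    rw [Finset.sum_mul, Finset.sum_mul]
    exact Finset.sum_le_sum fun j _ => mul_le_mul_of_nonneg_left (harr j)
      (mul_nonneg (M.lam_pos j).le (Nat.cast_nonneg _))
  have h2 : ∑ l, ∑ j, M.mu j * ((a.plc l j : ℝ) *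
      ∑ b, ((R.dep a l j b).toReal - if b = a then 1 else 0) * f b) ≤
      L * ((∑ j, M.mu j) * (B * E)) := by
    refine (Finset.sum_le_card_nsmul _ _ ((∑ j, M.mu j) * (B * E)) fun l _ => ?_).trans
      (by simp)
    rw [Finset.sum_mul]
    exact Finset.sum_le_sum fun j _ => mul_le_mul_of_nonneg_left (hdep l j) (M.mu_pos j).le
  refine (add_le_add h1 h2).trans (le_of_eq ?_)
  rw [CloudModel.rateBound]
  ring

/-! ### Oscillation of finite Markov chains -/

/-- A set of states that the generator does not leave is not left by the transition matrices. -/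
theorem matrix_exp_smul_apply_eq_zero {E : Type*} [Fintype E] [DecidableEq E] {Q : Matrix E E ℝ}
    {G : Set E} (hG : ∀ a ∈ G, ∀ b, b ∉ G → Q a b = 0) (t : ℝ) {a b : E} (ha : a ∈ G)
    (hb : b ∉ G) : NormedSpace.exp (t • Q) a b = 0 := by
  classical
  have h : (t • Q).BlockTriangular (fun a => if a ∈ G then 1 else 0 : E → ℕ) := by
    intro i j hij
    by_cases hi : i ∈ G <;> by_cases hj : j ∈ G <;> simp [hi, hj] at hij
    simp [hG i hi j hj]
  exact h.exp (by simp [ha, hb])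

open scoped Matrix.Norms.Operator in
theorem hasDerivAt_matrix_exp_apply {E : Type*} [Fintype E] [DecidableEq E] (Q : Matrix E E ℝ)
    (a b : E) : HasDerivAt (fun t : ℝ => NormedSpace.exp (t • Q) a b) (Q a b) 0 := by
  have h := hasDerivAt_exp_smul_const Q (0 : ℝ)
  rw [zero_smul, NormedSpace.exp_zero, one_mul] at h
  have h' := (LinearMap.toContinuousLinearMap (Matrix.entryLinearMap ℝ ℝ a b)).hasFDerivAt
    (x := NormedSpace.exp ((0 : ℝ) • Q))
  exact h'.comp_hasDerivAt _ h

/-- The transition matrix over a short time, weighted by the exponential of the displacement. -/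
theorem eventually_sum_exp_le {E V : Type*} [Fintype E] [DecidableEq E] [PseudoMetricSpace V]
    {Q : Matrix E E ℝ} {G : Set E} (F : E → V) {Λ : ℝ}
    (hΛ : ∀ a ∈ G, ∑ b, Q a b * Real.exp (dist (F a) (F b)) ≤ Λ)
    (hQ : ∀ a b, b ≠ a → 0 ≤ Q a b) :
    ∀ᶠ δ in 𝓝[>] (0 : ℝ), ∀ a ∈ G,
      ∑ b, ENNReal.ofReal (NormedSpace.exp (δ • Q) a b) *
        ENNReal.ofReal (Real.exp (dist (F a) (F b))) ≤
          ENNReal.ofReal (Real.exp (δ * (Λ + 1))) := by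
  set T : ℝ := ∑ a, ∑ b, Real.exp (dist (F a) (F b)) with hT
  have hT0 : 0 ≤ T := Finset.sum_nonneg fun a _ => Finset.sum_nonneg fun b _ => (Real.exp_pos _).le
  set η : ℝ := 1 / (1 + T) with hη
  have hη0 : 0 < η := by positivity
  have h1 : ∀ a b, ∀ᶠ δ in 𝓝[>] (0 : ℝ), NormedSpace.exp (δ • Q) a b ≤
      (if a = b then 1 else 0) + δ * (Q a b + η) := by
    intro a b
    have h2 := (hasDerivAt_matrix_exp_apply Q a b).isLittleO.def hη0
    have h3 : ∀ᶠ δ in 𝓝[>] (0 : ℝ), _ := h2.filter_mono nhdsWithin_le_nhds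
    filter_upwards [h3, self_mem_nhdsWithin] with δ hδ hpos
    have hpos : 0 < δ := hpos
    have h4 : NormedSpace.exp ((0 : ℝ) • Q) a b = if a = b then 1 else 0 := by
      rw [zero_smul, NormedSpace.exp_zero, Matrix.one_apply]
    rw [h4, sub_zero, smul_eq_mul, Real.norm_eq_abs, Real.norm_eq_abs, abs_of_pos hpos] at hδ
    have := (abs_le.1 hδ).2
    linarith
  have h2 : ∀ a b, ∀ᶠ δ in 𝓝[>] (0 : ℝ),
      0 ≤ (if a = b then 1 else 0) + δ * (Q a b + η) := by
    intro a b
    by_cases hab : a = b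
    · have : Tendsto (fun δ : ℝ => (if a = b then 1 else 0) + δ * (Q a b + η)) (𝓝 0) (𝓝 1) := by
        have : Continuous (fun δ : ℝ => (if a = b then (1 : ℝ) else 0) + δ * (Q a b + η)) := by
          fun_prop
        simpa [hab] using this.tendsto 0
      exact ((this.eventually (lt_mem_nhds one_pos)).filter_mono nhdsWithin_le_nhds).mono
        fun δ h => le_of_lt h
    · filter_upwards [self_mem_nhdsWithin] with δ hpos
      have hpos : 0 < δ := hpos
      have := hQ a b (Ne.symm hab)
      rw [if_neg hab]
      positivity
  have h1' := eventually_all.2 fun a => eventually_all.2 (h1 a)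
  have h2' := eventually_all.2 fun a => eventually_all.2 (h2 a)
  filter_upwards [h1', h2', self_mem_nhdsWithin] with δ hle hnn hpos a ha
  have hpos : 0 < δ := hpos
  calc ∑ b, ENNReal.ofReal (NormedSpace.exp (δ • Q) a b) *
        ENNReal.ofReal (Real.exp (dist (F a) (F b)))
      ≤ ∑ b, ENNReal.ofReal (((if a = b then 1 else 0) + δ * (Q a b + η)) *
          Real.exp (dist (F a) (F b))) := by
        refine Finset.sum_le_sum fun b _ => ?_
        rw [ENNReal.ofReal_mul (hnn a b)]
        exact mul_le_mul_left (ENNReal.ofReal_le_ofReal (hle a b)) _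
    _ = ENNReal.ofReal (∑ b, ((if a = b then 1 else 0) + δ * (Q a b + η)) *
          Real.exp (dist (F a) (F b))) :=
        (ENNReal.ofReal_sum_of_nonneg fun b _ => mul_nonneg (hnn a b) (Real.exp_pos _).le).symm
    _ ≤ ENNReal.ofReal (Real.exp (δ * (Λ + 1))) := by
        refine ENNReal.ofReal_le_ofReal ?_
        have h3 : ∑ b, ((if a = b then 1 else 0) + δ * (Q a b + η)) *
            Real.exp (dist (F a) (F b)) =
            1 + δ * (∑ b, Q a b * Real.exp (dist (F a) (F b)) +
              η * ∑ b, Real.exp (dist (F a) (F b))) := by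
          simp only [add_mul, Finset.sum_add_distrib, Finset.mul_sum, mul_add, ite_mul, one_mul,
            zero_mul, Finset.sum_ite_eq, Finset.mem_univ, if_true, dist_self, Real.exp_zero]
          simp only [mul_assoc]
        have h4 : η * ∑ b, Real.exp (dist (F a) (F b)) ≤ 1 := by
          have h5 : ∑ b, Real.exp (dist (F a) (F b)) ≤ T :=
            Finset.single_le_sum (f := fun a => ∑ b, Real.exp (dist (F a) (F b)))
              (fun a _ => Finset.sum_nonneg fun b _ => (Real.exp_pos _).le) (Finset.mem_univ a)
          rw [hη, one_div_mul_eq_div]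
          exact div_le_one_of_le₀ (by linarith) (by linarith)
        rw [h3]
        have h5 := Real.add_one_le_exp (δ * (Λ + 1))
        have h6 := mul_le_mul_of_nonneg_left (add_le_add (hΛ a ha) h4) hpos.le
        linarith

theorem tendsto_div_natCast (d : ℝ≥0) :
    Tendsto (fun N : ℕ => d / (N : ℝ≥0)) atTop (𝓝 0) := by
  rw [← NNReal.tendsto_coe]
  push_cast
  exact tendsto_const_nhds.div_atTop tendsto_natCast_atTop_atTop

theorem exists_grid_point {a t u δ : ℝ≥0} (hat : a ≤ t) (hδ : 0 < δ) (htu : t + δ < u) :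
    ∃ i : ℕ, t < a + i * δ ∧ a + i * δ < u := by
  refine ⟨⌊(t - a) / δ⌋₊ + 1, ?_, ?_⟩
  · have h1 := Nat.lt_floor_add_one ((t - a) / δ)
    rw [div_lt_iff₀ hδ, tsub_lt_iff_left hat] at h1
    exact_mod_cast h1
  · have h1 := Nat.floor_le (zero_le : 0 ≤ (t - a) / δ)
    rw [le_div_iff₀ hδ, le_tsub_iff_left hat] at h1
    refine lt_of_le_of_lt ?_ htu
    push_cast
    rw [add_mul, one_mul, ← add_assoc]
    gcongr

theorem IsMarkovChain.measurable_past {E Ω : Type*} [MeasurableSpace E] (S : ℝ≥0 → Ω → E)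
    {r s : ℝ≥0} (hrs : r ≤ s) :
    Measurable[⨆ r ∈ Set.Iic s, MeasurableSpace.comap (S r) inferInstance] (S r) :=
  Measurable.of_comap_le (le_iSup₂ (f := fun r _ => MeasurableSpace.comap (S r) inferInstance)
    r hrs)

section MarkovChain

variable {E : Type*} [Fintype E] [DecidableEq E] [MeasurableSpace E]
  {Q : Matrix E E ℝ} {Ω : Type*} [MeasurableSpace Ω] {S : ℝ≥0 → Ω → E} {P : Measure Ω}

/-- The Markov property for integrals of functions of the past. -/
theorem IsMarkovChain.setLIntegral_eq [IsFiniteMeasure P] (h : IsMarkovChain Q S P) (s δ : ℝ≥0)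
    (a b : E) {W : Ω → ℝ≥0∞}
    (hW : Measurable[⨆ r ∈ Set.Iic s, MeasurableSpace.comap (S r) inferInstance] W) :
    ∫⁻ ω in {ω | S s ω = a} ∩ {ω | S (s + δ) ω = b}, W ω ∂P =
      ENNReal.ofReal (NormedSpace.exp ((δ : ℝ) • Q) a b) * ∫⁻ ω in {ω | S s ω = a}, W ω ∂P := by
  have hm : (⨆ r ∈ Set.Iic s, MeasurableSpace.comap (S r) inferInstance) ≤
      (inferInstance : MeasurableSpace Ω) :=
    iSup₂_le fun r _ => (h.measurable r).comap_le
  have htrim : (P.restrict ({ω | S s ω = a} ∩ {ω | S (s + δ) ω = b})).trim hm =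
      ENNReal.ofReal (NormedSpace.exp ((δ : ℝ) • Q) a b) •
        (P.restrict {ω | S s ω = a}).trim hm := by
    refine @Measure.ext _ (_) _ _ fun A hA => ?_
    rw [Measure.smul_apply, smul_eq_mul, trim_measurableSet_eq hm hA, trim_measurableSet_eq hm hA,
      Measure.restrict_apply (hm _ hA), Measure.restrict_apply (hm _ hA), ← Set.inter_assoc]
    have := h.markov s δ a b A hA
    rw [← ofReal_measureReal (h := measure_ne_top _ _), this,
      ENNReal.ofReal_mul measureReal_nonneg, ofReal_measureReal (h := measure_ne_top _ _), mul_comm]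
  rw [← lintegral_trim hm hW, ← lintegral_trim hm hW, htrim, lintegral_smul_measure, smul_eq_mul]

theorem IsMarkovChain.ae_mem [IsProbabilityMeasure P] (h : IsMarkovChain Q S P) {G : Set E}
    (hG : ∀ a ∈ G, ∀ b, b ∉ G → Q a b = 0) (h0 : ∀ᵐ ω ∂P, S 0 ω ∈ G) (t : ℝ≥0) :
    ∀ᵐ ω ∂P, S t ω ∈ G := by
  have key : ∀ b, b ∉ G → ∀ a, P ({ω | S 0 ω = a} ∩ {ω | S t ω = b}) = 0 := by
    intro b hb a
    by_cases ha : a ∈ G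
    · have := h.setLIntegral_eq 0 t a b (W := fun _ => 1) (@measurable_const _ _ _ (_) 1)
      rw [matrix_exp_smul_apply_eq_zero hG _ ha hb] at this
      simpa using this
    · refine measure_mono_null (fun ω hω => ?_) h0
      simp only [Set.mem_inter_iff, Set.mem_ofPred_eq] at hω
      simpa [hω.1] using ha
  have hnull : P (⋃ a, ⋃ b ∈ Gᶜ, ({ω | S 0 ω = a} ∩ {ω | S t ω = b})) = 0 :=
    measure_iUnion_null fun a => (measure_biUnion_null_iff (Set.to_countable _)).2
      fun b hb => key b hb a
  refine measure_mono_null (fun ω hω => ?_) hnull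
  simp only [Set.mem_iUnion, Set.mem_inter_iff, Set.mem_ofPred_eq]
  exact ⟨S 0 ω, S t ω, hω, rfl, rfl⟩

/-- Every value of the path on `[a, a + h]` is attained at some point of every sufficiently fine
regular grid. -/
theorem IsMarkovChain.eventually_exists_grid (h : IsMarkovChain Q S P) (ω : Ω) {a d t : ℝ≥0}
    (hd : 0 < d) (hat : a ≤ t) (hta : t ≤ a + d) :
    ∀ᶠ N : ℕ in atTop, ∃ i ≤ N, S (a + i * (d / N)) ω = S t ω := by
  rcases eq_or_lt_of_le hta with rfl | hlt
  · filter_upwards [eventually_ne_atTop 0] with N hN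
    refine ⟨N, le_rfl, ?_⟩
    rw [mul_div_cancel₀ _ (by exact_mod_cast hN)]
  · obtain ⟨u, hu, hsub⟩ := mem_nhdsGT_iff_exists_Ioo_subset.1 (h.right_cont ω t)
    have hu : t < u := hu
    have h1 : Tendsto (fun N : ℕ => t + d / (N : ℝ≥0)) atTop (𝓝 (t + 0)) :=
      tendsto_const_nhds.add (tendsto_div_natCast d)
    rw [add_zero] at h1
    filter_upwards [h1.eventually (gt_mem_nhds (lt_min hu hlt)), eventually_gt_atTop 0]
      with N hN hN0
    have hN0' : (0 : ℝ≥0) < N := by exact_mod_cast hN0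
    obtain ⟨i, hi1, hi2⟩ := exists_grid_point hat (div_pos hd hN0') hN
    refine ⟨i, ?_, hsub ⟨hi1, hi2.trans_le (min_le_left _ _)⟩⟩
    have h2 := hi2.trans_le (min_le_right _ _)
    rw [add_lt_add_iff_left, ← mul_div_assoc, div_lt_iff₀ hN0', mul_comm d, mul_lt_mul_iff_left₀ hd]
      at h2
    exact_mod_cast h2.le

variable [MeasurableSingletonClass E]

/-- Multiplicative functionals of a chain observed at times `a + i * δ` grow at most
geometrically, with the largest weighted row sum of the transition matrix as ratio. -/
theorem IsMarkovChain.lintegral_prod_le [IsProbabilityMeasure P] (h : IsMarkovChain Q S P)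
    {G : Set E} (hG : ∀ t, ∀ᵐ ω ∂P, S t ω ∈ G) (w : E → E → ℝ≥0∞) (δ : ℝ≥0) (ρ : ℝ≥0∞)
    (hw : ∀ a ∈ G, ∑ b, ENNReal.ofReal (NormedSpace.exp ((δ : ℝ) • Q) a b) * w a b ≤ ρ)
    (t : ℝ≥0) (N : ℕ) :
    ∫⁻ ω, ∏ i ∈ Finset.range N, w (S (t + i * δ) ω) (S (t + (i + 1 : ℕ) * δ) ω) ∂P ≤ ρ ^ N := by
  induction N with
  | zero => simp
  | succ N ih =>
    set s : ℝ≥0 := t + N * δ with hs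
    have hsδ : t + (N + 1 : ℕ) * δ = s + δ := by rw [hs]; push_cast; ring
    set W : Ω → ℝ≥0∞ := fun ω =>
      ∏ i ∈ Finset.range N, w (S (t + i * δ) ω) (S (t + (i + 1 : ℕ) * δ) ω) with hWdef
    have hW : Measurable[⨆ r ∈ Set.Iic s, MeasurableSpace.comap (S r) inferInstance] W := by
      refine @Finset.measurable_fun_prod _ _ _ _ _ _ (_) _ _ fun i hi => ?_
      have hi' : i + 1 ≤ N := Finset.mem_range.1 hi
      have h1 : t + (i + 1 : ℕ) * δ ≤ s := by rw [hs]; gcongr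
      have h2 : t + i * δ ≤ s := by rw [hs]; gcongr; omega
      have hw2 : Measurable (fun p : E × E => w p.1 p.2) := Measurable.of_discrete
      exact hw2.comp (Measurable.prodMk (IsMarkovChain.measurable_past S h2)
        (IsMarkovChain.measurable_past S h1))
    have hm : (⨆ r ∈ Set.Iic s, MeasurableSpace.comap (S r) inferInstance) ≤
        (inferInstance : MeasurableSpace Ω) :=
      iSup₂_le fun r _ => (h.measurable r).comap_le
    have hW' : Measurable W := hW.mono hm le_rfl
    have hset : ∀ (r : ℝ≥0) (a : E), MeasurableSet {ω | S r ω = a} := fun r a =>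
      h.measurable r (measurableSet_singleton a)
    have hsum : ∀ ω, W ω = ∑ a, {ω | S s ω = a}.indicator W ω := by
      intro ω
      rw [Finset.sum_eq_single (S s ω)]
      · rw [Set.indicator_of_mem]; rfl
      · intro b _ hb
        exact Set.indicator_of_notMem (fun h => hb h.symm) _
      · simp
    have hsum2 : ∀ ω, W ω * w (S s ω) (S (s + δ) ω) =
        ∑ a, ∑ b, ({ω | S s ω = a} ∩ {ω | S (s + δ) ω = b}).indicator
          (fun ω => w a b * W ω) ω := by
      intro ω
      rw [Finset.sum_eq_single (S s ω), Finset.sum_eq_single (S (s + δ) ω)]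
      · rw [Set.indicator_of_mem
          (show ω ∈ {ω' | S s ω' = S s ω} ∩
            {ω' | S (s + δ) ω' = S (s + δ) ω} from ⟨rfl, rfl⟩), mul_comm]
      · intro b _ hb
        exact Set.indicator_of_notMem (fun h => hb h.2.symm) _
      · simp
      · intro a _ ha
        exact Finset.sum_eq_zero fun b _ => Set.indicator_of_notMem (fun h => ha h.1.symm) _
      · simp
    calc ∫⁻ ω, ∏ i ∈ Finset.range (N + 1),
          w (S (t + i * δ) ω) (S (t + (i + 1 : ℕ) * δ) ω) ∂P
        = ∫⁻ ω, W ω * w (S s ω) (S (s + δ) ω) ∂P := by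
          simp only [Finset.prod_range_succ, hsδ]
          rfl
      _ = ∑ a, ∑ b, w a b * ∫⁻ ω in {ω | S s ω = a} ∩ {ω | S (s + δ) ω = b}, W ω ∂P := by
          simp only [hsum2]
          rw [lintegral_finsetSum _ fun a _ => Finset.measurable_fun_sum _ fun b _ =>
            (hW'.const_mul _).indicator ((hset _ _).inter (hset _ _))]
          refine Finset.sum_congr rfl fun a _ => ?_
          rw [lintegral_finsetSum _ fun b _ =>
            (hW'.const_mul _).indicator ((hset _ _).inter (hset _ _))]
          refine Finset.sum_congr rfl fun b _ => ?_
          rw [lintegral_indicator ((hset _ _).inter (hset _ _)), lintegral_const_mul _ hW']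
      _ = ∑ a, (∑ b, ENNReal.ofReal (NormedSpace.exp ((δ : ℝ) • Q) a b) * w a b) *
            ∫⁻ ω in {ω | S s ω = a}, W ω ∂P := by
          refine Finset.sum_congr rfl fun a _ => ?_
          rw [Finset.sum_mul]
          refine Finset.sum_congr rfl fun b _ => ?_
          rw [h.setLIntegral_eq s δ a b hW]
          ring
      _ ≤ ∑ a, ρ * ∫⁻ ω in {ω | S s ω = a}, W ω ∂P := by
          refine Finset.sum_le_sum fun a _ => ?_
          by_cases ha : a ∈ G
          · exact mul_le_mul_left (hw a ha) _
          · have : P {ω | S s ω = a} = 0 := by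
              refine measure_mono_null (fun ω hω => ?_) (hG s)
              simp only [Set.mem_ofPred_eq] at hω
              simpa [hω] using ha
            rw [setLIntegral_measure_zero _ _ this, mul_zero, mul_zero]
      _ = ρ * ∫⁻ ω, W ω ∂P := by
          rw [← Finset.mul_sum]
          congr 1
          rw [lintegral_congr hsum, lintegral_finsetSum _ fun a _ => hW'.indicator (hset _ _)]
          exact Finset.sum_congr rfl fun a _ => (lintegral_indicator (hset _ _) _).symm
      _ ≤ ρ ^ (N + 1) := by
          rw [pow_succ']
          exact mul_le_mul_right ih _

variable {V : Type*} [PseudoMetricSpace V]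

/-- A large deviation bound for the oscillation over a time interval, from the exponential moment
of the displacement. -/
theorem IsMarkovChain.measure_oscillation_le [IsProbabilityMeasure P] (h : IsMarkovChain Q S P)
    {G : Set E} (hG : ∀ a ∈ G, ∀ b, b ∉ G → Q a b = 0) (h0 : ∀ᵐ ω ∂P, S 0 ω ∈ G) (F : E → V)
    {Λ : ℝ} (hΛ : ∀ a ∈ G, ∑ b, Q a b * Real.exp (dist (F a) (F b)) ≤ Λ)
    (hQ : ∀ a b, b ≠ a → 0 ≤ Q a b) (a d : ℝ≥0) (hd : 0 < d) (v : ℝ) :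
    P {ω | ∃ t, a ≤ t ∧ t ≤ a + d ∧ v < dist (F (S a ω)) (F (S t ω))} ≤
      ENNReal.ofReal (Real.exp (d * (Λ + 1) - v)) := by
  set W : ℕ → Ω → ℝ≥0∞ := fun N ω => ∏ i ∈ Finset.range N, ENNReal.ofReal (Real.exp
    (dist (F (S (a + i * (d / N)) ω)) (F (S (a + (i + 1 : ℕ) * (d / N)) ω)))) with hW
  have hWeq : ∀ N ω, W N ω = ENNReal.ofReal (Real.exp (∑ i ∈ Finset.range N,
      dist (F (S (a + i * (d / N)) ω)) (F (S (a + (i + 1 : ℕ) * (d / N)) ω)))) := by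
    intro N ω
    rw [hW, Real.exp_sum, ENNReal.ofReal_prod_of_nonneg fun i _ => (Real.exp_pos _).le]
  have hWm : ∀ N, Measurable (W N) := by
    intro N
    refine Finset.measurable_fun_prod _ fun i _ => ?_
    have hw2 : Measurable (fun p : E × E => ENNReal.ofReal (Real.exp (dist (F p.1) (F p.2)))) :=
      Measurable.of_discrete
    exact hw2.comp ((h.measurable _).prodMk (h.measurable _))
  set D : ℕ → Set Ω := fun N => {ω | ENNReal.ofReal (Real.exp v) ≤ W N ω} with hD
  have hDle : ∀ᶠ N in atTop, P (D N) ≤ ENNReal.ofReal (Real.exp (d * (Λ + 1) - v)) := by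
    have h1 : Tendsto (fun N : ℕ => ((d / (N : ℝ≥0) : ℝ≥0) : ℝ)) atTop (𝓝[>] 0) := by
      refine tendsto_nhdsWithin_iff.2 ⟨?_, ?_⟩
      · push_cast
        exact tendsto_const_nhds.div_atTop tendsto_natCast_atTop_atTop
      · filter_upwards [eventually_gt_atTop 0] with N hN
        have : (0 : ℝ≥0) < d / N := div_pos hd (by exact_mod_cast hN)
        exact_mod_cast this
    filter_upwards [h1.eventually (eventually_sum_exp_le F hΛ hQ), eventually_gt_atTop 0]
      with N hN hN0
    have h2 := h.lintegral_prod_le (h.ae_mem hG h0)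
      (fun x y => ENNReal.ofReal (Real.exp (dist (F x) (F y)))) (d / N) _ hN a N
    have h3 : (ENNReal.ofReal (Real.exp (((d / N : ℝ≥0) : ℝ) * (Λ + 1)))) ^ N =
        ENNReal.ofReal (Real.exp (d * (Λ + 1))) := by
      rw [← ENNReal.ofReal_pow (Real.exp_pos _).le, ← Real.exp_nat_mul]
      congr 2
      push_cast
      have : (N : ℝ) ≠ 0 := by exact_mod_cast hN0.ne'
      field_simp
    rw [h3] at h2
    have h4 := mul_meas_ge_le_lintegral (μ := P) (hWm N) (ENNReal.ofReal (Real.exp v))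
    rw [sub_eq_add_neg, Real.exp_add, Real.exp_neg, ENNReal.ofReal_mul (Real.exp_pos _).le,
      ENNReal.ofReal_inv_of_pos (Real.exp_pos _), ← div_eq_mul_inv,
      ENNReal.le_div_iff_mul_le (.inl (by simp [Real.exp_pos])) (.inl ENNReal.ofReal_ne_top),
      mul_comm]
    exact h4.trans h2
  -- `W N` bounds the exponential of the displacement once the grid is fine enough
  have hsub : {ω | ∃ t, a ≤ t ∧ t ≤ a + d ∧ v < dist (F (S a ω)) (F (S t ω))} ⊆
      ⋃ n, ⋂ N ∈ Set.Ici n, D N := by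
    rintro ω ⟨t, hat, hta, hv⟩
    obtain ⟨n, hn⟩ := eventually_atTop.1 (h.eventually_exists_grid ω hd hat hta)
    refine Set.mem_iUnion.2 ⟨n, Set.mem_iInter₂.2 fun N hN => ?_⟩
    obtain ⟨i, hiN, hi⟩ := hn N hN
    show ENNReal.ofReal (Real.exp v) ≤ W N ω
    rw [hWeq]
    refine ENNReal.ofReal_le_ofReal (Real.exp_le_exp.2 (hv.le.trans ?_))
    have h1 := dist_le_range_sum_dist (fun i : ℕ => F (S (a + i * (d / N)) ω)) i
    simp only [Nat.cast_zero, zero_mul, add_zero, hi] at h1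
    exact h1.trans (Finset.sum_le_sum_of_subset_of_nonneg (Finset.range_mono hiN)
      fun _ _ _ => dist_nonneg)
  have hmono : Monotone fun n => ⋂ N ∈ Set.Ici n, D N := by
    intro n m hnm
    exact Set.biInter_subset_biInter_left (Set.Ici_subset_Ici.2 hnm)
  refine (measure_mono hsub).trans ?_
  rw [hmono.measure_iUnion]
  refine iSup_le fun n => ?_
  obtain ⟨N, hN, hnN⟩ := (hDle.and (eventually_ge_atTop n)).exists
  exact (measure_mono (Set.biInter_subset_of_mem hnN)).trans hN

end MarkovChain

/-! ### Compactness of asymptotically Lipschitz sequences of paths -/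

section Paths

variable {V : Type*} [PseudoMetricSpace V]

/-- A sequence of paths that is Lipschitz up to errors that vanish, uniformly on compact time
intervals, as the index grows; the paths may have jumps. -/
def AsympLipschitz (C : ℝ≥0) (f : ℕ → ℝ≥0 → V) : Prop :=
  ∀ (T : ℝ≥0) (ε : ℝ), 0 < ε → ∀ᶠ n in atTop, ∀ s t, s ≤ T → t ≤ T →
    dist (f n s) (f n t) ≤ C * dist s t + ε

theorem AsympLipschitz.comp {C : ℝ≥0} {f : ℕ → ℝ≥0 → V} (hf : AsympLipschitz C f) {φ : ℕ → ℕ}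
    (hφ : StrictMono φ) : AsympLipschitz C fun n => f (φ n) :=
  fun T ε hε => hφ.tendsto_atTop.eventually (hf T ε hε)

/-- It suffices to control the oscillation over the cells of regular grids. -/
theorem AsympLipschitz.of_grid {C : ℝ≥0} {f : ℕ → ℝ≥0 → V}
    (h : ∀ m i : ℕ, ∀ᶠ n in atTop, ∀ t : ℝ≥0, i * (1 / (m + 1 : ℝ≥0)) ≤ t →
      t ≤ i * (1 / (m + 1 : ℝ≥0)) + 1 / (m + 1 : ℝ≥0) →
        dist (f n (i * (1 / (m + 1 : ℝ≥0)))) (f n t) ≤ C * (1 / (m + 1 : ℝ))) :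
    AsympLipschitz C f := by
  intro T ε hε
  obtain ⟨m, hm⟩ := exists_nat_one_div_lt (show 0 < ε / (3 * C + 1) by positivity)
  set d : ℝ≥0 := 1 / (m + 1 : ℝ≥0) with hd
  have hd0 : 0 < d := by positivity
  have hdr : (d : ℝ) = 1 / (m + 1 : ℝ) := by rw [hd]; push_cast; rfl
  have hCd : 3 * (C * (d : ℝ)) ≤ ε := by
    rw [← hdr, lt_div_iff₀ (by positivity)] at hm
    nlinarith [hd0.le, NNReal.coe_nonneg d]
  have h1 : ∀ᶠ n in atTop, ∀ i ∈ Finset.range (⌊T / d⌋₊ + 1), ∀ t : ℝ≥0, i * d ≤ t →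
      t ≤ i * d + d → dist (f n (i * d)) (f n t) ≤ C * (d : ℝ) := by
    rw [Filter.eventually_all_finset]
    intro i _
    rw [hdr]
    exact h m i
  filter_upwards [h1] with n hn
  have key : ∀ s t, s ≤ t → t ≤ T → dist (f n s) (f n t) ≤ C * dist s t + ε := by
    intro s t hst htT
    set i := ⌊s / d⌋₊ with hi
    set j := ⌊t / d⌋₊ with hj
    have hij : i ≤ j := Nat.floor_mono (by gcongr)
    have hjT : j ≤ ⌊T / d⌋₊ := Nat.floor_mono (by gcongr)
    have hlow : ∀ r : ℝ≥0, (⌊r / d⌋₊ : ℝ≥0) * d ≤ r := fun r => by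
      rw [← le_div_iff₀ hd0]; exact Nat.floor_le (zero_le : 0 ≤ r / d)
    have hup : ∀ r : ℝ≥0, r ≤ (⌊r / d⌋₊ : ℝ≥0) * d + d := fun r => by
      have := (Nat.lt_floor_add_one (r / d)).le
      rwa [div_le_iff₀ hd0, add_mul, one_mul] at this
    have h2 := hn i (by simp; omega) s (hlow s) (hup s)
    have h3 := hn j (by simp; omega) t (hlow t) (hup t)
    have h4 : dist (f n (i * d)) (f n (j * d)) ≤ ((j : ℝ) - i) * (C * (d : ℝ)) := by
      refine (dist_le_Ico_sum_dist (fun k : ℕ => f n (k * d)) hij).trans ?_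
      refine (Finset.sum_le_card_nsmul _ _ (C * (d : ℝ)) fun k hk => ?_).trans (le_of_eq ?_)
      · rw [Finset.mem_Ico] at hk
        refine hn k (by simp; omega) _ ?_ ?_
        · gcongr; omega
        · push_cast; rw [add_mul, one_mul]
      · rw [Nat.card_Ico, nsmul_eq_mul, Nat.cast_sub hij]
    have h5 : ((j : ℝ) - i) * d ≤ t - s + d := by
      have h6 : ((j : ℝ≥0) * d : ℝ≥0) ≤ t := hlow t
      have h7 : s ≤ (i : ℝ≥0) * d + d := hup s
      have h6' : (j : ℝ) * d ≤ t := by exact_mod_cast h6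
      have h7' : (s : ℝ) ≤ i * d + d := by exact_mod_cast h7
      linarith
    have h8 : dist s t = t - s := by
      rw [NNReal.dist_eq, abs_sub_comm, abs_of_nonneg (sub_nonneg.2 (by exact_mod_cast hst))]
    rw [h8]
    have h9 := dist_triangle4 (f n s) (f n (i * d)) (f n (j * d)) (f n t)
    rw [dist_comm (f n s) (f n (i * d))] at h9
    have h10 := mul_le_mul_of_nonneg_left h5 (NNReal.coe_nonneg C)
    linarith
  intro s t hs ht
  rcases le_total s t with hst | hst
  · exact key s t hst ht
  · rw [dist_comm, dist_comm s]; exact key t s hst hs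

theorem UOC.tendsto {f : ℕ → ℝ≥0 → V} {z : ℝ≥0 → V} (h : UOC f z) (t : ℝ≥0) :
    Tendsto (fun n => f n t) atTop (𝓝 (z t)) :=
  (h t).tendsto_at ⟨zero_le, le_rfl⟩

theorem AsympLipschitz.lipschitzWith {C : ℝ≥0} {f : ℕ → ℝ≥0 → V} (hf : AsympLipschitz C f)
    {z : ℝ≥0 → V} (hz : UOC f z) : LipschitzWith C z := by
  refine LipschitzWith.of_dist_le_mul fun s t => le_of_forall_pos_le_add fun ε hε => ?_
  refine le_of_tendsto ((hz.tendsto s).dist (hz.tendsto t)) ?_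
  filter_upwards [hf (max s t) ε hε] with n hn
  exact hn s t (le_max_left _ _) (le_max_right _ _)

/-- Convergence at all grid points upgrades to uniform convergence on compact intervals. -/
theorem AsympLipschitz.exists_uoc [CompleteSpace V] {C : ℝ≥0} {f : ℕ → ℝ≥0 → V}
    (hf : AsympLipschitz C f)
    (h : ∀ m i : ℕ, ∃ x, Tendsto (fun n => f n (i * (1 / (m + 1 : ℝ≥0)))) atTop (𝓝 x)) :
    ∃ z, UOC f z := by
  have hC : ∀ T : ℝ≥0, UniformCauchySeqOn f atTop (Set.Icc 0 T) := by
    intro T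
    rw [Metric.uniformCauchySeqOn_iff]
    intro ε hε
    obtain ⟨m, hm⟩ := exists_nat_one_div_lt (show 0 < ε / (8 * C + 1) by positivity)
    set d : ℝ≥0 := 1 / (m + 1 : ℝ≥0) with hd
    have hd0 : 0 < d := by positivity
    have hdr : (d : ℝ) = 1 / (m + 1 : ℝ) := by rw [hd]; push_cast; rfl
    have hCd : 8 * (C * (d : ℝ)) ≤ ε := by
      rw [← hdr, lt_div_iff₀ (by positivity)] at hm
      nlinarith [hd0.le, NNReal.coe_nonneg d]
    have h1 : ∀ᶠ N in atTop, ∀ i ∈ Finset.range (⌊T / d⌋₊ + 1), ∀ n, N ≤ n → ∀ n', N ≤ n' →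
        dist (f n (i * d)) (f n' (i * d)) < ε / 4 := by
      rw [Filter.eventually_all_finset]
      intro i _
      obtain ⟨x, hx⟩ := h m i
      obtain ⟨N, hN⟩ := Metric.cauchySeq_iff.1 hx.cauchySeq (ε / 4) (by positivity)
      filter_upwards [eventually_ge_atTop N] with N' hN' n hn n' hn'
      exact hN n (hN'.trans hn) n' (hN'.trans hn')
    obtain ⟨N₁, hN₁⟩ := h1.exists
    obtain ⟨N₂, hN₂⟩ := eventually_atTop.1 (hf T (ε / 8) (by positivity))
    refine ⟨max N₁ N₂, fun n hn n' hn' t ht => ?_⟩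
    have hn1 := (le_max_left _ _).trans hn
    have hn2 := (le_max_right _ _).trans hn
    have hn1' := (le_max_left _ _).trans hn'
    have hn2' := (le_max_right _ _).trans hn'
    set i := ⌊t / d⌋₊ with hi
    have hiT : i ≤ ⌊T / d⌋₊ := Nat.floor_mono (by gcongr; exact ht.2)
    have hlow : (i : ℝ≥0) * d ≤ t := by
      rw [← le_div_iff₀ hd0]; exact Nat.floor_le (zero_le : 0 ≤ t / d)
    have hup : t ≤ (i : ℝ≥0) * d + d := by
      have := (Nat.lt_floor_add_one (t / d)).le
      rwa [div_le_iff₀ hd0, add_mul, one_mul] at this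
    have hdist : dist ((i : ℝ≥0) * d) t ≤ d := by
      rw [NNReal.dist_eq, abs_sub_comm, abs_of_nonneg (sub_nonneg.2 (by exact_mod_cast hlow))]
      have : (t : ℝ) ≤ ((i : ℝ≥0) * d : ℝ≥0) + d := by exact_mod_cast hup
      linarith
    have hmid := hN₁ i (by simp; omega) n hn1 n' hn1'
    have ha := hN₂ n hn2 _ _ (hlow.trans ht.2) ht.2
    have hb := hN₂ n' hn2' _ _ (hlow.trans ht.2) ht.2
    have hc := mul_le_mul_of_nonneg_left hdist (NNReal.coe_nonneg C)
    have h9 := dist_triangle4 (f n t) (f n (i * d)) (f n' (i * d)) (f n' t)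
    rw [dist_comm (f n t) (f n (i * d))] at h9
    linarith
  have hlim : ∀ t, ∃ x, Tendsto (fun n => f n t) atTop (𝓝 x) := fun t =>
    cauchySeq_tendsto_of_complete ((hC t).cauchySeq ⟨zero_le, le_rfl⟩)
  choose z hz using hlim
  exact ⟨z, fun T => (hC T).tendstoUniformlyOn_of_tendsto fun t _ => hz t⟩

end Paths

theorem AsympLipschitz.exists_subseq_uoc {V : Type*} [MetricSpace V] {C : ℝ≥0}
    {f : ℕ → ℝ≥0 → V} (hf : AsympLipschitz C f) {K : Set V} (hK : IsCompact K) [CompleteSpace V]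
    (hfK : ∀ n t, f n t ∈ K) : ∃ ψ : ℕ → ℕ, StrictMono ψ ∧ ∃ z, UOC (fun n => f (ψ n)) z := by
  have hcomp : IsCompact (Set.univ.pi fun _ : ℕ × ℕ => K) := isCompact_univ_pi fun _ => hK
  obtain ⟨x, -, ψ, hψ, hlim⟩ := hcomp.tendsto_subseq
    (x := fun n (q : ℕ × ℕ) => f n (q.2 * (1 / (q.1 + 1 : ℝ≥0)))) fun n q _ => hfK n _
  rw [tendsto_pi_nhds] at hlim
  exact ⟨ψ, hψ, (hf.comp hψ).exists_uoc fun m i => ⟨x (m, i), hlim (m, i)⟩⟩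

/-! ### Almost sure regularity of the scaled state processes -/

instance {J : ℕ} {M : CloudModel J} {L : ℕ} : MeasurableSingletonClass (State M L) :=
  ⟨fun _ => trivial⟩

/-- Over a time interval of length `d`, the scaled state moves by more than a constant multiple of
`d` only with probability exponentially small in the number of servers. -/
theorem IsDRAProcess.measure_oscillation_le {B : ℕ}
    (hB : ∀ (k : M.Config) (j : Fin J), k.1 j ≤ B) {L : ℕ} {γ : ℝ} {R : Rule M L γ} {Ω : Type*}
    [MeasurableSpace Ω] {P : Measure Ω} [IsProbabilityMeasure P] {S : ℝ≥0 → Ω → State M L}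
    (hS : IsDRAProcess R S P) {c : ℝ} (hc : M.rateBound B * Real.exp (jumpBound J B) ≤ c)
    (hL : 0 < L) (a d : ℝ≥0) (hd : 0 < d) :
    P {ω | ∃ t, a ≤ t ∧ t ≤ a + d ∧
      2 * c * d < dist (R.scaled (S a ω)) (R.scaled (S t ω))} ≤
      ENNReal.ofReal (Real.exp d * Real.exp (-(d * c)) ^ L) := by
  have hL' : (0 : ℝ) < L := by exact_mod_cast hL
  have h1 := hS.chain.measure_oscillation_le (G := R.stableStates)
    (fun a ha b hb => R.generator_eq_zero ha hb)
    (hS.init.mono fun ω ⟨s₀, h⟩ => CRA.mem_stableStates R h) R.unscaled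
    (fun a ha => (R.sum_generator_mul_exp_le hB ha).trans
      (mul_le_mul_of_nonneg_right hc hL'.le))
    (fun a b hab => R.generator_nonneg hab) a d hd (2 * c * d * L)
  have hset : {ω | ∃ t, a ≤ t ∧ t ≤ a + d ∧
      2 * c * d < dist (R.scaled (S a ω)) (R.scaled (S t ω))} =
      {ω | ∃ t, a ≤ t ∧ t ≤ a + d ∧
        2 * c * d * L < dist (R.unscaled (S a ω)) (R.unscaled (S t ω))} := by
    ext ω
    simp only [Set.mem_ofPred_eq, Rule.unscaled, dist_smul₀, Real.norm_natCast]
    simp only [mul_comm _ (L : ℝ), mul_lt_mul_iff_right₀ hL']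
  rw [hset]
  refine h1.trans (ENNReal.ofReal_le_ofReal ?_)
  rw [← Real.exp_nat_mul, ← Real.exp_add]
  refine Real.exp_le_exp.2 (le_of_eq ?_)
  ring

/-- Almost surely, the scaled state processes are asymptotically Lipschitz, with a constant that
depends only on the model. -/
theorem exists_forall_ae_asympLipschitz (M : CloudModel J) : ∃ C : ℝ≥0,
    ∀ (L : ℕ → ℕ), StrictMono L → ∀ (γ : ℕ → ℝ) (R : ∀ n, Rule M (L n) (γ n)) (Ω : Type u)
      (_ : MeasurableSpace Ω) (P : Measure Ω), IsProbabilityMeasure P →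
      ∀ (S : ∀ n, ℝ≥0 → Ω → State M (L n)), (∀ n, IsDRAProcess (R n) (S n) P) →
        ∀ᵐ ω ∂P, AsympLipschitz C fun n t => (R n).scaled (S n t ω) := by
  obtain ⟨B, -, hB⟩ := M.exists_slot_bound
  set c : ℝ := M.rateBound B * Real.exp (jumpBound J B) + 1 with hc
  have hc0 : 0 < c := by
    have := M.rateBound_nonneg B
    positivity
  refine ⟨⟨2 * c, by positivity⟩, fun L hL γ R Ω _ P _ S hS => ?_⟩
  have key : ∀ m i : ℕ, ∀ᵐ ω ∂P, ∀ᶠ n in atTop, ω ∉ {ω | ∃ t : ℝ≥0,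
      i * (1 / (m + 1 : ℝ≥0)) ≤ t ∧ t ≤ i * (1 / (m + 1 : ℝ≥0)) + 1 / (m + 1 : ℝ≥0) ∧
        2 * c * (1 / (m + 1 : ℝ≥0) : ℝ≥0) <
          dist ((R n).scaled (S n (i * (1 / (m + 1 : ℝ≥0))) ω)) ((R n).scaled (S n t ω))} := by
    intro m i
    set d : ℝ≥0 := 1 / (m + 1 : ℝ≥0) with hd
    have hd0 : 0 < d := by positivity
    have hd0' : (0 : ℝ) < d := by exact_mod_cast hd0
    have hlt : Real.exp (-(d * c)) < 1 := by
      rw [Real.exp_lt_one_iff]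
      have := mul_pos hd0' hc0
      linarith
    refine ae_eventually_notMem ?_
    have hsum : Summable fun n : ℕ => Real.exp d * Real.exp (-(d * c)) ^ n :=
      (summable_geometric_of_lt_one (Real.exp_pos _).le hlt).mul_left _
    refine ne_top_of_le_ne_top hsum.tsum_ofReal_ne_top (ENNReal.tsum_le_tsum fun n => ?_)
    rcases Nat.eq_zero_or_pos n with rfl | hn0
    -- the system with index `0` may have no servers, but there the bound is trivial
    · refine prob_le_one.trans ?_
      rw [pow_zero, mul_one, ENNReal.one_le_ofReal, Real.one_le_exp_iff]
      exact hd0'.le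
    have hn : n ≤ L n := hL.id_le n
    refine ((hS n).measure_oscillation_le hB (c := c) (by rw [hc]; linarith) (by omega)
      _ d hd0).trans (ENNReal.ofReal_le_ofReal ?_)
    refine mul_le_mul_of_nonneg_left ?_ (Real.exp_pos _).le
    exact pow_le_pow_of_le_one (Real.exp_pos _).le hlt.le hn
  have key' := ae_all_iff.2 fun m => ae_all_iff.2 (key m)
  filter_upwards [key'] with ω hω
  refine AsympLipschitz.of_grid fun m i => ?_
  filter_upwards [hω m i] with n hn t h1 h2
  by_contra hlt
  rw [not_le] at hlt
  refine hn ⟨t, h1, h2, ?_⟩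
  push_cast
  exact hlt

/-! ### Processes on an extension of the probability space -/

section Transfer

variable {Ω Ω' : Type*} [MeasurableSpace Ω] [MeasurableSpace Ω'] {P : Measure Ω}
  {P' : Measure Ω'} {π : Ω' → Ω}

theorem IsMarkovChain.comp {E : Type*} [Fintype E] [DecidableEq E] [MeasurableSpace E]
    {Q : Matrix E E ℝ} {S : ℝ≥0 → Ω → E} (h : IsMarkovChain Q S P)
    [MeasurableSingletonClass E] (hπ : MeasurePreserving π P' P) :
    IsMarkovChain Q (fun t ω => S t (π ω)) P' where
  measurable t := (h.measurable t).comp hπ.measurable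
  right_cont ω t := h.right_cont (π ω) t
  left_lim ω t := h.left_lim (π ω) t
  markov s t a b A hA := by
    have hcomap : (⨆ r ∈ Set.Iic s, MeasurableSpace.comap (fun ω => S r (π ω)) inferInstance) =
        MeasurableSpace.comap π
          (⨆ r ∈ Set.Iic s, MeasurableSpace.comap (S r) inferInstance) := by
      simp only [MeasurableSpace.comap_iSup, MeasurableSpace.comap_comp]
      rfl
    rw [hcomap] at hA
    obtain ⟨A', hA', rfl⟩ := hA
    have hm : (⨆ r ∈ Set.Iic s, MeasurableSpace.comap (S r) inferInstance) ≤
        (inferInstance : MeasurableSpace Ω) :=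
      iSup₂_le fun r _ => (h.measurable r).comap_le
    have hset : ∀ (r : ℝ≥0) (a : E), MeasurableSet {ω | S r ω = a} := fun r a =>
      h.measurable r (measurableSet_singleton a)
    have h1 := hπ.measureReal_preimage
      (((hm _ hA').inter (hset s a)).inter (hset (s + t) b)).nullMeasurableSet
    have h2 := hπ.measureReal_preimage ((hm _ hA').inter (hset s a)).nullMeasurableSet
    have h3 := h.markov s t a b A' hA'
    rw [← h1, ← h2] at h3
    exact h3

theorem IsDRAProcess.comp {J : ℕ} {M : CloudModel J} {L : ℕ} {γ : ℝ} {R : Rule M L γ}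
    {S : ℝ≥0 → Ω → State M L} (h : IsDRAProcess R S P) (hπ : MeasurePreserving π P' P) :
    IsDRAProcess R (fun t ω => S t (π ω)) P' where
  chain := h.chain.comp hπ
  init := hπ.quasiMeasurePreserving.ae h.init

end Transfer

/-! ### Coupling along a subsequence -/

section Coupling

open ProbabilityTheory

variable {Ω : Type*} [MeasurableSpace Ω] {P : Measure Ω}

theorem lintegral_comp_fintype {α : Type*} [Fintype α] [MeasurableSpace α]
    [MeasurableSingletonClass α] {X : Ω → α} (hX : Measurable X) (g : α → ℝ≥0∞) :
    ∫⁻ ω, g (X ω) ∂P = ∑ a, g a * P (X ⁻¹' {a}) := by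
  rw [← lintegral_map (Measurable.of_discrete : Measurable g) hX, lintegral_fintype]
  exact Finset.sum_congr rfl fun a _ => by rw [Measure.map_apply hX (measurableSet_singleton a)]

/-- Maximal coupling of two finitely valued random variables, as a transition kernel: from a
sample point for `X` it produces a sample point for `Y`, preserving the probability, such that the
two values differ with probability at most the total variation distance of the laws. -/
theorem exists_kernel_coupling {α : Type*} [Fintype α] [MeasurableSpace α]
    [MeasurableSingletonClass α] [IsProbabilityMeasure P] {X Y : Ω → α} (hX : Measurable X)
    (hY : Measurable Y) : ∃ K : Kernel Ω Ω, IsMarkovKernel K ∧ K ∘ₘ P = P ∧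
      ∫⁻ ω, K ω {ω' | Y ω' ≠ X ω} ∂P ≤ ∑ a, (P (Y ⁻¹' {a}) - P (X ⁻¹' {a})) := by
  classical
  set p : α → ℝ≥0∞ := fun a => P (X ⁻¹' {a}) with hp
  set q : α → ℝ≥0∞ := fun a => P (Y ⁻¹' {a}) with hq
  set m : α → ℝ≥0∞ := fun a => min (p a) (q a) with hm
  set e : α → ℝ≥0∞ := fun a => q a - p a with he
  set w : α → ℝ≥0∞ := fun a => m a / p a with hw
  set c : α → Measure Ω := fun a => ProbabilityTheory.cond P (Y ⁻¹' {a}) with hc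
  have hptop : ∀ a, p a ≠ ∞ := fun a => measure_ne_top _ _
  have hqtop : ∀ a, q a ≠ ∞ := fun a => measure_ne_top _ _
  have hmtop : ∀ a, m a ≠ ∞ := fun a => ne_top_of_le_ne_top (hptop a) (min_le_left _ _)
  have hw1 : ∀ a, w a ≤ 1 := fun a => ENNReal.div_le_of_le_mul (by simp [hm])
  have hpw : ∀ a, w a * p a = m a := by
    intro a
    by_cases h0 : p a = 0
    · simp [hm, h0]
    · exact ENNReal.div_mul_cancel h0 (hptop a)
  have hme : ∀ a, m a + e a = q a := by
    intro a
    rcases le_total (p a) (q a) with h | h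
    · simp only [hm, he, min_eq_left h]; exact add_tsub_cancel_of_le h
    · simp only [hm, he, min_eq_right h, tsub_eq_zero_of_le h, add_zero]
  have hpm : ∀ a, (1 - w a) * p a + m a = p a := by
    intro a
    rw [← hpw a, ← add_mul, tsub_add_cancel_of_le (hw1 a), one_mul]
  have hsum : ∀ {Z : Ω → α}, Measurable Z → ∑ a, P (Z ⁻¹' {a}) = 1 := by
    intro Z hZ
    have := lintegral_comp_fintype (P := P) hZ (fun _ => 1)
    simpa using this.symm
  have hΔ : ∑ a, (1 - w a) * p a = ∑ a, e a := by
    have h1 : ∑ a, (1 - w a) * p a + ∑ a, m a = 1 := by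
      rw [← Finset.sum_add_distrib]
      refine Eq.trans ?_ (hsum hX)
      exact Finset.sum_congr rfl fun a _ => hpm a
    have h2 : ∑ a, e a + ∑ a, m a = 1 := by
      rw [← Finset.sum_add_distrib]
      refine Eq.trans ?_ (hsum hY)
      exact Finset.sum_congr rfl fun a _ => by rw [add_comm]; exact hme a
    have h3 : ∑ a, m a ≠ ∞ := (ENNReal.sum_ne_top.2 fun a _ => hmtop a)
    exact (ENNReal.add_left_inj h3).1 (h1.trans h2.symm)
  set Δ : ℝ≥0∞ := ∑ a, e a with hΔdef
  have hΔtop : Δ ≠ ∞ :=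
    ENNReal.sum_ne_top.2 fun a _ => ne_top_of_le_ne_top (hqtop a) tsub_le_self
  have hcprob : ∀ a, q a ≠ 0 → c a Set.univ = 1 := by
    intro a ha
    have := cond_isProbabilityMeasure (μ := P) ha
    exact measure_univ
  -- the conditional law of the second point when the two values are not matched
  obtain ⟨ν, hν, hνe⟩ : ∃ ν : Measure Ω, IsProbabilityMeasure ν ∧
      ∀ A, Δ * ν A = ∑ a, e a * c a A := by
    by_cases h0 : Δ = 0
    · refine ⟨P, inferInstance, fun A => ?_⟩
      rw [h0, zero_mul]
      have h0' := (Finset.sum_eq_zero_iff.1 h0)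
      exact (Finset.sum_eq_zero fun a ha => by rw [h0' a ha, zero_mul]).symm
    · have hA : ∀ A, (Δ⁻¹ • ∑ a, e a • c a) A = Δ⁻¹ * ∑ a, e a * c a A := by
        intro A
        simp [Measure.finsetSum_apply]
      refine ⟨Δ⁻¹ • ∑ a, e a • c a, ⟨?_⟩, fun A => ?_⟩
      · rw [hA]
        have : ∑ a, e a * c a Set.univ = Δ := by
          refine Finset.sum_congr rfl fun a _ => ?_
          by_cases hqa : q a = 0
          · simp [he, hqa]
          · rw [hcprob a hqa, mul_one]
        rw [this, ENNReal.inv_mul_cancel h0 hΔtop]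
      · rw [hA, ← mul_assoc, ENNReal.mul_inv_cancel h0 hΔtop, one_mul]
  let κ : Kernel α Ω := Kernel.ofFunOfCountable fun a => w a • c a + (1 - w a) • ν
  have hκ : ∀ a A, κ a A = w a * c a A + (1 - w a) * ν A := fun a A => by
    show (w a • c a + (1 - w a) • ν) A = _
    simp
  have hwc : ∀ a, w a * c a Set.univ = w a := by
    intro a
    by_cases hqa : q a = 0
    · simp [hw, hm, hqa]
    · rw [hcprob a hqa, mul_one]
  refine ⟨κ.comap X hX, ⟨fun ω => ⟨?_⟩⟩, ?_, ?_⟩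
  · rw [Kernel.comap_apply, hκ, hwc, measure_univ, mul_one, add_tsub_cancel_of_le (hw1 _)]
  · ext A hA
    rw [Measure.bind_apply hA (Kernel.aemeasurable _)]
    simp only [Kernel.comap_apply]
    rw [lintegral_comp_fintype hX (fun a => κ a A)]
    have h1 : ∀ a, κ a A * P (X ⁻¹' {a}) = m a * c a A + (1 - w a) * p a * ν A := by
      intro a
      rw [hκ, ← hpw a]
      ring
    simp only [h1]
    rw [Finset.sum_add_distrib, ← Finset.sum_mul, hΔ, hνe, ← Finset.sum_add_distrib]
    have h2 := congrArg (fun μ : Measure Ω => μ A) (sum_meas_smul_cond_fiber hY P)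
    simp only [Measure.finsetSum_apply, Measure.smul_apply, smul_eq_mul] at h2
    refine Eq.trans (Finset.sum_congr rfl fun a _ => ?_) h2
    rw [← add_mul, hme a]
  · have h1 : ∀ ω, (κ.comap X hX) ω {ω' | Y ω' ≠ X ω} ≤ 1 - w (X ω) := by
      intro ω
      have h2 : c (X ω) {ω' | Y ω' ≠ X ω} = 0 := by
        rw [hc, cond_apply (hY (measurableSet_singleton _))]
        have : Y ⁻¹' {X ω} ∩ {ω' | Y ω' ≠ X ω} = ∅ := by
          ext ω'
          simp
        rw [this, measure_empty, mul_zero]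
      rw [Kernel.comap_apply, hκ, h2, mul_zero, zero_add]
      exact mul_le_of_le_one_right zero_le prob_le_one
    refine (lintegral_mono h1).trans ?_
    rw [lintegral_comp_fintype hX (fun a => 1 - w a)]
    exact hΔ.le

/-- Chaining of couplings: there is a law on sequences of sample points, with all marginals equal
to the given probability, for which consecutive points are maximally coupled. -/
theorem exists_chain_coupling [IsProbabilityMeasure P] {α : ℕ → Type*} [∀ j, Fintype (α j)]
    [∀ j, MeasurableSpace (α j)] [∀ j, MeasurableSingletonClass (α j)]
    {X Y : ∀ j, Ω → α j} (hX : ∀ j, Measurable (X j)) (hY : ∀ j, Measurable (Y j)) :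
    ∃ P' : Measure (ℕ → Ω), IsProbabilityMeasure P' ∧
      (∀ j, MeasurePreserving (fun w : ℕ → Ω => w j) P' P) ∧
      ∀ j, P' {w | Y j (w (j + 1)) ≠ X j (w j)} ≤
        ∑ a, (P (Y j ⁻¹' {a}) - P (X j ⁻¹' {a})) := by
  choose K hK hKP hKle using fun j => exists_kernel_coupling (P := P) (hX j) (hY j)
  let κ : (n : ℕ) → Kernel ((i : Finset.Iic n) → Ω) Ω := fun n =>
    (K n).comap (fun x => x ⟨n, Finset.mem_Iic.2 le_rfl⟩) (measurable_pi_apply _)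
  have hκ : ∀ n, IsMarkovKernel (κ n) := fun n => by infer_instance
  let P' : Measure (ℕ → Ω) := Kernel.trajMeasure (X := fun _ => Ω) P κ
  have hP' : IsProbabilityMeasure P' := by
    show IsProbabilityMeasure (Kernel.trajMeasure (X := fun _ => Ω) P κ)
    infer_instance
  -- the joint law of the point with index `j + 1` and its past
  have hjoint : ∀ (j : ℕ) (A : Set (((i : Finset.Iic j) → Ω) × Ω)), MeasurableSet A →
      P' {w | (Preorder.frestrictLe j w, w (j + 1)) ∈ A} =
        ∫⁻ w, K j (w j) {ω | (Preorder.frestrictLe j w, ω) ∈ A} ∂P' := by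
    intro j A hA
    have h1 := Kernel.map_frestrictLe_trajMeasure_compProd_eq_map_trajMeasure
      (X := fun _ => Ω) (μ₀ := P) (κ := κ) (a := j)
    have h2 := congrArg (fun μ => μ A) h1
    rw [Measure.map_apply (by fun_prop) hA, Measure.compProd_apply hA,
      lintegral_map (Kernel.measurable_kernel_prodMk_left hA) (by fun_prop)] at h2
    exact h2.symm
  have hmarg : ∀ j, P'.map (fun w : ℕ → Ω => w j) = P := by
    intro j
    induction j with
    | zero =>
      show (Kernel.trajMeasure (X := fun _ => Ω) P κ).map _ = P
      have h1 : (fun w : ℕ → Ω => w 0) = (fun x : (i : Finset.Iic 0) → Ω =>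
          x ⟨0, Finset.mem_Iic.2 le_rfl⟩) ∘ Preorder.frestrictLe (π := fun _ => Ω) 0 := rfl
      rw [h1, ← Measure.map_map (measurable_pi_apply _) (by fun_prop), Kernel.trajMeasure,
        Measure.map_comp _ _ (by fun_prop), Kernel.traj_map_frestrictLe, Kernel.partialTraj_self,
        Measure.id_comp, Measure.map_map (measurable_pi_apply _) (by fun_prop)]
      exact Measure.map_id
    | succ j ih =>
      ext A hA
      rw [Measure.map_apply (measurable_pi_apply _) hA]
      have h1 := hjoint j (Prod.snd ⁻¹' A) (measurable_snd hA)
      have h2 : ∫⁻ w, K j (w j) A ∂P' = P A := by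
        rw [← lintegral_map (f := fun ω => K j ω A) (g := fun w : ℕ → Ω => w j)
          ((K j).measurable_coe hA) (measurable_pi_apply j), ih,
          ← Measure.bind_apply hA (Kernel.aemeasurable _), hKP]
      rw [← h2]
      exact h1
  refine ⟨P', hP', fun j => ⟨measurable_pi_apply j, hmarg j⟩, fun j => ?_⟩
  let A : Set (((i : Finset.Iic j) → Ω) × Ω) :=
    {x | Y j x.2 ≠ X j (x.1 ⟨j, Finset.mem_Iic.2 le_rfl⟩)}
  have hA : MeasurableSet A :=
    (measurableSet_eq_fun ((hY j).comp measurable_snd)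
      ((hX j).comp ((measurable_pi_apply _).comp measurable_fst))).compl
  have h1 := hjoint j A hA
  have h3 : MeasurableSet {x : Ω × Ω | Y j x.2 ≠ X j x.1} :=
    (measurableSet_eq_fun ((hY j).comp measurable_snd) ((hX j).comp measurable_fst)).compl
  have h2 : ∫⁻ w, K j (w j) {ω | Y j ω ≠ X j (w j)} ∂P' =
      ∫⁻ ω, K j ω {ω' | Y j ω' ≠ X j ω} ∂P := by
    conv_rhs => rw [← hmarg j]
    refine (lintegral_map (f := fun ω => K j ω {ω' | Y j ω' ≠ X j ω}) ?_
      (measurable_pi_apply j)).symm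
    exact Kernel.measurable_kernel_prodMk_left h3
  refine le_trans (le_of_eq ?_) (hKle j)
  rw [← h2]
  exact h1

/-- Discretization of the first `j` terms of a sequence in `[0, B]` to the grid of mesh `2⁻ʲ`. -/
noncomputable def discretize (B j : ℕ) (x : ℕ → ℝ) : Fin j → Fin (B * 2 ^ j + 1) := fun i =>
  Fin.ofNat _ ⌊2 ^ j * x i⌋₊

theorem measurable_discretize (B j : ℕ) {f : Ω → ℕ → ℝ} (hf : ∀ i, Measurable fun ω => f ω i) :
    Measurable fun ω => discretize B j (f ω) := by
  refine measurable_pi_lambda _ fun i => ?_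
  exact (Measurable.of_discrete (f := fun k : ℕ => Fin.ofNat (B * 2 ^ j + 1) k)).comp
    (((hf i).const_mul _).nat_floor)

theorem abs_sub_le_of_discretize_eq {B j : ℕ} {x y : ℕ → ℝ} (hx : ∀ i, 0 ≤ x i ∧ x i ≤ B)
    (hy : ∀ i, 0 ≤ y i ∧ y i ≤ B) (h : discretize B j x = discretize B j y) {i : ℕ}
    (hi : i < j) : |x i - y i| ≤ (1 / 2) ^ j := by
  have hpos : (0 : ℝ) < 2 ^ j := by positivity
  have hlt : ∀ z : ℕ → ℝ, (∀ i, 0 ≤ z i ∧ z i ≤ B) →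
      ((discretize B j z ⟨i, hi⟩ : Fin _) : ℕ) = ⌊2 ^ j * z i⌋₊ := by
    intro z hz
    refine Nat.mod_eq_of_lt (Nat.lt_succ_of_le (Nat.floor_le_of_le ?_))
    push_cast
    rw [mul_comm]
    exact mul_le_mul_of_nonneg_right (hz i).2 hpos.le
  have h1 := congrArg Fin.val (congrFun h ⟨i, hi⟩)
  rw [hlt x hx, hlt y hy] at h1
  have h2 := Nat.floor_le (mul_nonneg hpos.le (hx i).1)
  have h3 := Nat.lt_floor_add_one (2 ^ j * x i)
  have h4 := Nat.floor_le (mul_nonneg hpos.le (hy i).1)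
  have h5 := Nat.lt_floor_add_one (2 ^ j * y i)
  rw [← h1] at h4 h5
  rw [one_div, inv_pow, ← mul_one ((2 : ℝ) ^ j)⁻¹, ← div_eq_inv_mul, le_div_iff₀ hpos]
  have h6 : |x i - y i| * 2 ^ j = |(x i - y i) * 2 ^ j| := by rw [abs_mul, abs_of_pos hpos]
  rw [h6, abs_le]
  constructor <;> linarith

/-- A version of the Skorokhod representation theorem for bounded random sequences: along a
subsequence there is a coupling for which all terms converge almost surely. The coupling consists
of sample points of the original probability space. -/
theorem exists_coupling_tendsto [IsProbabilityMeasure P] {B : ℕ} {f : ℕ → Ω → ℕ → ℝ}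
    (hf : ∀ n i, Measurable fun ω => f n ω i) (hfB : ∀ n ω i, 0 ≤ f n ω i ∧ f n ω i ≤ B) :
    ∃ φ : ℕ → ℕ, StrictMono φ ∧ ∃ P' : Measure (ℕ → Ω), IsProbabilityMeasure P' ∧
      (∀ j, MeasurePreserving (fun w : ℕ → Ω => w j) P' P) ∧
      ∀ᵐ w ∂P', ∀ i, ∃ x, Tendsto (fun j => f (φ j) (w j) i) atTop (𝓝 x) := by
  let α : ℕ → Type := fun j => Fin j → Fin (B * 2 ^ j + 1)
  let Z : ∀ _ : ℕ, ∀ j, Ω → α j := fun n j ω => discretize B j (f n ω)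
  have hZ : ∀ n j, Measurable (Z n j) := fun n j => measurable_discretize B j (hf n)
  -- along a subsequence, the laws of all discretizations converge
  have hcomp : IsCompact (Set.univ.pi fun _ : Σ j, α j => Set.Icc (0 : ℝ) 1) :=
    isCompact_univ_pi fun _ => isCompact_Icc
  obtain ⟨l, -, ψ, hψ, hlim⟩ := hcomp.tendsto_subseq
    (x := fun n (s : Σ j, α j) => P.real (Z n s.1 ⁻¹' {s.2}))
    fun n s _ => ⟨measureReal_nonneg, measureReal_le_one⟩
  rw [tendsto_pi_nhds] at hlim
  have hev : ∀ j, ∀ᶠ N in atTop, ∀ n ≥ N, ∀ n' ≥ N,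
      ∑ a, (P (Z (ψ n') j ⁻¹' {a}) - P (Z (ψ n) j ⁻¹' {a})) ≤ ENNReal.ofReal ((1 / 2) ^ j) := by
    intro j
    have h1 : Tendsto (fun n (a : α j) => P.real (Z (ψ n) j ⁻¹' {a})) atTop
        (𝓝 fun a => l ⟨j, a⟩) := tendsto_pi_nhds.2 fun a => hlim ⟨j, a⟩
    set ε : ℝ := (1 / 2) ^ j / (Fintype.card (α j) + 1) with hε
    have hε0 : 0 < ε := by positivity
    obtain ⟨N₀, hN₀⟩ := Metric.cauchySeq_iff.1 h1.cauchySeq ε hε0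
    filter_upwards [eventually_ge_atTop N₀] with N hN n hn n' hn'
    have h2 := (hN₀ n' (hN.trans hn') n (hN.trans hn)).le
    rw [dist_pi_le_iff hε0.le] at h2
    calc ∑ a, (P (Z (ψ n') j ⁻¹' {a}) - P (Z (ψ n) j ⁻¹' {a}))
        ≤ ∑ _a : α j, ENNReal.ofReal ε := by
          refine Finset.sum_le_sum fun a _ => ?_
          rw [← ofReal_measureReal (h := measure_ne_top P (Z (ψ n') j ⁻¹' {a})),
            ← ofReal_measureReal (h := measure_ne_top P (Z (ψ n) j ⁻¹' {a})),
            ← ENNReal.ofReal_sub _ measureReal_nonneg]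
          exact ENNReal.ofReal_le_ofReal ((le_abs_self _).trans (h2 a))
      _ = ENNReal.ofReal (Fintype.card (α j) * ε) := by
          rw [Finset.sum_const, Finset.card_univ, nsmul_eq_mul,
            ENNReal.ofReal_mul (Nat.cast_nonneg _), ENNReal.ofReal_natCast]
      _ ≤ ENNReal.ofReal ((1 / 2) ^ j) := by
          refine ENNReal.ofReal_le_ofReal ?_
          rw [hε, mul_div_assoc']
          rw [div_le_iff₀ (by positivity)]
          have : (0 : ℝ) < (1 / 2) ^ j := by positivity
          linarith
  obtain ⟨χ, hχ, hχle⟩ := extraction_forall_of_eventually hev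
  obtain ⟨P', hP', hmarg, hle⟩ := exists_chain_coupling (P := P) (X := fun j => Z (ψ (χ j)) j)
    (Y := fun j => Z (ψ (χ (j + 1))) j) (fun j => hZ _ _) (fun j => hZ _ _)
  refine ⟨fun j => ψ (χ j), hψ.comp hχ, P', hP', hmarg, ?_⟩
  have hsum : ∑' j, P' {w | Z (ψ (χ (j + 1))) j (w (j + 1)) ≠ Z (ψ (χ j)) j (w j)} ≠ ∞ := by
    have h1 : Summable fun j : ℕ => ((1 : ℝ) / 2) ^ j := summable_geometric_two
    refine ne_top_of_le_ne_top h1.tsum_ofReal_ne_top (ENNReal.tsum_le_tsum fun j => ?_)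
    exact (hle j).trans (hχle j _ le_rfl _ (hχ (Nat.lt_succ_self j)).le)
  filter_upwards [ae_eventually_notMem hsum] with w hw i
  obtain ⟨N, hN⟩ := eventually_atTop.1 hw
  have hcauchy : CauchySeq fun j => f (ψ (χ (j + (N + i + 1)))) (w (j + (N + i + 1))) i := by
    refine cauchySeq_of_le_geometric (1 / 2) 1 (by norm_num) fun j => ?_
    have h1 := hN (j + (N + i + 1)) (by omega)
    simp only [not_not] at h1
    have h2 := abs_sub_le_of_discretize_eq (hfB _ _) (hfB _ _) h1 (i := i) (by omega)
    rw [dist_comm, Real.dist_eq, one_mul]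
    have h3 : j + 1 + (N + i + 1) = j + (N + i + 1) + 1 := by omega
    rw [h3]
    exact h2.trans (pow_le_pow_of_le_one (by norm_num) (by norm_num) (by omega))
  obtain ⟨x, hx⟩ := cauchySeq_tendsto_of_complete hcauchy
  exact ⟨x, (tendsto_add_atTop_iff_nat (f := fun j => f (ψ (χ j)) (w j) i) (N + i + 1)).1 hx⟩

end Coupling

/-! ### Existence of fluid limits -/

/-- A coordinate of a fluid state. -/
def coord : M.GreedyConfig ⊕ Fin J → (M.GreedyConfig → ℝ) × (Fin J → ℝ) → ℝ
  | .inl k, z => z.1 k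
  | .inr j, z => z.2 j

theorem exists_tendsto_of_coord {x : ℕ → (M.GreedyConfig → ℝ) × (Fin J → ℝ)}
    (h : ∀ q, ∃ l, Tendsto (fun n => coord q (x n)) atTop (𝓝 l)) :
    ∃ z, Tendsto x atTop (𝓝 z) := by
  choose l hl using h
  refine ⟨(fun k => l (.inl k), fun j => l (.inr j)), ?_⟩
  exact (tendsto_pi_nhds.2 fun k => hl (.inl k)).prodMk_nhds
    (tendsto_pi_nhds.2 fun j => hl (.inr j))

theorem Rule.coord_scaled_mem {B : ℕ} (hB0 : 0 < B)
    (hB : ∀ (k : M.Config) (j : Fin J), k.1 j ≤ B) {L : ℕ} {γ : ℝ} (R : Rule M L γ)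
    (s : State M L) (q : M.GreedyConfig ⊕ Fin J) :
    0 ≤ coord q (R.scaled s) ∧ coord q (R.scaled s) ≤ B := by
  have h := R.scaled_mem_closedBall hB0 hB s
  rw [Metric.mem_closedBall, Prod.dist_eq, max_le_iff, dist_pi_le_iff (Nat.cast_nonneg _),
    dist_pi_le_iff (Nat.cast_nonneg _)] at h
  rcases q with k | j
  · refine ⟨R.scaled_nonneg s k, (le_abs_self _).trans ?_⟩
    simpa [Real.dist_eq, coord] using h.1 k
  · refine ⟨?_, (le_abs_self _).trans ?_⟩
    · show 0 ≤ (s.Y j : ℝ) / (L : ℝ)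
      positivity
    · simpa [Real.dist_eq, coord] using h.2 j

end DRA

theorem mainTheorem9 {J : ℕ} (M : DRA.CloudModel J) (g : ℕ → ℝ) (hg_nonneg : ∀ L, 0 ≤ g L)
    (hg_log : (fun L : ℕ => Real.log (L : ℝ)) =o[atTop] g)
    (hg_lin : g =o[atTop] fun L : ℕ => (L : ℝ))
    (L : ℕ → ℕ) (hL : StrictMono L) (R : ∀ n, DRA.Rule M (L n) (g (L n)))
    {Ω : Type u} [MeasurableSpace Ω] (P : Measure Ω) [IsProbabilityMeasure P]
    (S : ∀ n, ℝ≥0 → Ω → DRA.State M (L n)) (hS : ∀ n, DRA.IsDRAProcess (R n) (S n) P) :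
    ∃ C : ℝ≥0,
      -- for any joint construction, pathwise: relative compactness, and regularity of all limits
      (∀ᵐ ω ∂P,
        (∀ φ : ℕ → ℕ, StrictMono φ → ∃ ψ : ℕ → ℕ, StrictMono ψ ∧
          ∃ z : ℝ≥0 → (M.GreedyConfig → ℝ) × (Fin J → ℝ),
            DRA.UOC (fun n t => (R (φ (ψ n))).scaled (S (φ (ψ n)) t ω)) z) ∧
        (∀ φ : ℕ → ℕ, StrictMono φ → ∀ z : ℝ≥0 → (M.GreedyConfig → ℝ) × (Fin J → ℝ),
          DRA.UOC (fun n t => (R (φ n)).scaled (S (φ n) t ω)) z →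
            LipschitzWith C z ∧ ∀ t, z t ∈ M.Z)) ∧
      -- on a suitable probability space: almost sure convergence along a nonrandom subsequence
      (∃ (Ω' : Type u) (_ : MeasurableSpace Ω') (P' : Measure Ω')
        (S' : ∀ n, ℝ≥0 → Ω' → DRA.State M (L n)),
        IsProbabilityMeasure P' ∧
        (∀ n, DRA.IsDRAProcess (R n) (S' n) P' ∧
          P'.map (fun ω t => S' n t ω) = P.map (fun ω t => S n t ω)) ∧
        ∃ φ : ℕ → ℕ, StrictMono φ ∧
          ∃ z : Ω' → ℝ≥0 → (M.GreedyConfig → ℝ) × (Fin J → ℝ),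
            ∀ᵐ ω ∂P', DRA.UOC (fun n t => (R (φ n)).scaled (S' (φ n) t ω)) (z ω) ∧
              LipschitzWith C (z ω) ∧ ∀ t, z ω t ∈ M.Z) := by
  obtain ⟨B, hB0, hB⟩ := M.exists_slot_bound
  obtain ⟨C, hC⟩ := DRA.exists_forall_ae_asympLipschitz.{u} M
  have hγL : Tendsto (fun n => g (L n) / (L n : ℝ)) atTop (𝓝 0) :=
    hg_lin.tendsto_div_nhds_zero.comp hL.tendsto_atTop
  have hZ : ∀ φ : ℕ → ℕ, StrictMono φ → ∀ (s : ∀ n, ℝ≥0 → DRA.State M (L n))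
      (z : ℝ≥0 → (M.GreedyConfig → ℝ) × (Fin J → ℝ)),
      DRA.UOC (fun n t => (R (φ n)).scaled (s (φ n) t)) z → ∀ t, z t ∈ M.Z := by
    intro φ hφ s z hz t
    exact DRA.mem_Z_of_tendsto (fun n => hg_nonneg (L (φ n)))
      (hL.tendsto_atTop.comp hφ.tendsto_atTop) (hγL.comp hφ.tendsto_atTop) (fun n => R (φ n))
      (fun n => s (φ n) t) (hz.tendsto t)
  refine ⟨C, ?_, ?_⟩
  · filter_upwards [hC L hL _ R Ω _ P inferInstance S hS] with ω hω
    refine ⟨fun φ hφ => ?_, fun φ hφ z hz => ⟨(hω.comp hφ).lipschitzWith hz,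
      hZ φ hφ (fun n t => S n t ω) z hz⟩⟩
    exact (hω.comp hφ).exists_subseq_uoc (isCompact_closedBall 0 (B : ℝ))
      fun n t => (R (φ n)).scaled_mem_closedBall hB0 hB _
  · -- the sequence of all coordinates of the scaled state at all grid points
    have : Nonempty M.GreedyConfig := ⟨⟨⟨0, M.zero_mem⟩, .inl rfl⟩⟩
    obtain ⟨enc, henc⟩ := exists_surjective_nat ((ℕ × ℕ) × (M.GreedyConfig ⊕ Fin J))
    let f : ℕ → Ω → ℕ → ℝ := fun n ω i => DRA.coord (enc i).2
      ((R n).scaled (S n ((enc i).1.2 * (1 / ((enc i).1.1 + 1 : ℝ≥0))) ω))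
    have hf : ∀ n i, Measurable fun ω => f n ω i := fun n i =>
      (Measurable.of_discrete (f := fun s => DRA.coord (enc i).2 ((R n).scaled s))).comp
        ((hS n).chain.measurable _)
    obtain ⟨φ, hφ, P', hP', hmarg, hconv⟩ := DRA.exists_coupling_tendsto (P := P) (B := B) hf
      (fun n ω i => (R n).coord_scaled_mem hB0 hB _ _)
    -- the system with index `φ j` lives on the coordinate `j`
    let e : ℕ → ℕ := Function.invFun φ
    have he : ∀ j, e (φ j) = j := Function.leftInverse_invFun hφ.injective
    have hS' : ∀ n, DRA.IsDRAProcess (R n) (fun t (w : ℕ → Ω) => S n t (w (e n))) P' := fun n =>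
      (hS n).comp (hmarg (e n))
    refine ⟨ℕ → Ω, inferInstance, P', fun n t w => S n t (w (e n)), hP',
      fun n => ⟨hS' n, ?_⟩, φ, hφ, ?_⟩
    · have hm : Measurable fun ω t => S n t ω :=
        measurable_pi_lambda _ fun t => (hS n).chain.measurable t
      conv_rhs => rw [← (hmarg (e n)).map_eq]
      rw [Measure.map_map hm (hmarg (e n)).measurable]
      rfl
    · have hae : ∀ᵐ w ∂P', ∃ z : ℝ≥0 → (M.GreedyConfig → ℝ) × (Fin J → ℝ),
          DRA.UOC (fun n t => (R (φ n)).scaled (S (φ n) t (w (e (φ n))))) z ∧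
            LipschitzWith C z ∧ ∀ t, z t ∈ M.Z := by
        filter_upwards [hC L hL _ R _ _ P' hP' _ hS', hconv] with w hw hcw
        obtain ⟨z, hz⟩ := (hw.comp hφ).exists_uoc fun m k =>
          DRA.exists_tendsto_of_coord fun q => by
            obtain ⟨i, hi⟩ := henc ((m, k), q)
            obtain ⟨l, hl⟩ := hcw i
            refine ⟨l, hl.congr fun n => ?_⟩
            simp only [f, hi, he]
        exact ⟨z, hz, (hw.comp hφ).lipschitzWith hz,
          hZ φ hφ (fun n t => S n t (w (e n))) z hz⟩
      exact hae.choice
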